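/- Let $M$ be a complete connected smooth Riemannian manifold (without boundary) of finite dimension; for example, any closed connected Riemannian manifold. Let $l>0$ be a real number, let $x,y,z\in M$, and let $\gamma_1,\gamma_2:[0,1]\to M$ be two continuous paths from $x$ to $z$, each of length $\le l$. Suppose that $\mathrm{dist}(y,z)\le l$, and that there exists exactly one geodesic of length $\le 2l$ from $x$ to $y$. (Here a geodesic is a locally length-minimizing path, parametrized on $[0,1]$ proportionally to arc length; constant paths are geodesics, and $x=y$ is allowed.) Then there is a path homotopy from $\gamma_1$ to $\gamma_2$, that is, a continuous map $F:[0,1]\times[0,1]\to M$ with $F(0,t)=\gamma_1(t)$, $F(1,t)=\gamma_2(t)$, $F(s,0)=x$ and $F(s,1)=z$ for all $s,t$, such that for every $s\in[0,1]$ the path $F(s,\cdot)$ from $x$ to $z$ has length $\le 3l$. -/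

import Mathlib

open scoped Manifold ContDiff Bundle

/-- The length of a continuous path in a metric space: the supremum of the lengths of all inscribed
polygons, with values in `[0, ∞]`. -/
noncomputable def pathLength {X : Type*} [PseudoEMetricSpace X] {x y : X} (γ : Path x y) : ENNReal :=
  eVariationOn (γ : unitInterval → X) Set.univ

/-- A geodesic from `x` to `y`: a path that is parametrized on `[0, 1]` proportionally to arc length
and that locally minimizes the length, i.e. there is a speed `v ≥ 0` such that every parameter `t`
has a neighbourhood in which `dist (γ s) (γ s') = v * |s - s'|`. The constant path is the geodesic
of speed `v = 0`. -/
def IsGeodesicPath {X : Type*} [PseudoMetricSpace X] {x y : X} (γ : Path x y) : Prop :=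
  ∃ v : ℝ, 0 ≤ v ∧ ∀ t : unitInterval, ∃ U ∈ nhds t, ∀ s ∈ U, ∀ s' ∈ U,
    dist (γ s) (γ s') = v * |(s : ℝ) - (s' : ℝ)|

open scoped Manifold ContDiff Bundle
open Set Filter Topology MeasureTheory

section RiemannianLocal

variable {E : Type*} [NormedAddCommGroup E] [NormedSpace ℝ E]
  {M : Type*} [MetricSpace M] [ChartedSpace E M]
  [Bundle.RiemannianBundle (fun p : M => TangentSpace 𝓘(ℝ, E) p)]
  [IsRiemannianManifold 𝓘(ℝ, E) M]

/-- Points of a Riemannian manifold can be joined by a path whose partial lengths are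
controlled by a given upper bound of the distance. -/
lemma exists_path_of_dist_lt {p q : M} {r : ℝ} (h : dist p q < r) :
    ∃ γ : ℝ → M, γ 0 = p ∧ γ 1 = q ∧ ContMDiff 𝓘(ℝ, ℝ) 𝓘(ℝ, E) 1 γ ∧
      Manifold.pathELength 𝓘(ℝ, E) γ 0 1 < ENNReal.ofReal r := by
  have h' : Manifold.riemannianEDist 𝓘(ℝ, E) p q < ENNReal.ofReal r := by
    rw [← IsRiemannianManifold.out (I := 𝓘(ℝ, E)) p q, edist_dist]
    exact (ENNReal.ofReal_lt_ofReal_iff (dist_nonneg.trans_lt h)).2 h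
  obtain ⟨γ, h0, h1, hs, hl, -⟩ :=
    Manifold.exists_lt_locally_constant_of_riemannianEDist_lt h' zero_lt_one
  exact ⟨γ, h0, h1, hs, hl⟩

lemma edist_le_pathELength {γ : ℝ → M} (hγ : ContMDiff 𝓘(ℝ, ℝ) 𝓘(ℝ, E) 1 γ) {a b : ℝ}
    (hab : a ≤ b) : edist (γ a) (γ b) ≤ Manifold.pathELength 𝓘(ℝ, E) γ a b := by
  rw [IsRiemannianManifold.out (I := 𝓘(ℝ, E))]
  exact Manifold.riemannianEDist_le_pathELength hγ.contMDiffOn rfl rfl hab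

lemma exists_dist_lt_and_dist_lt (E : Type*) [NormedAddCommGroup E] [NormedSpace ℝ E]
    {M : Type*} [MetricSpace M] [ChartedSpace E M]
    [Bundle.RiemannianBundle (fun p : M => TangentSpace 𝓘(ℝ, E) p)]
    [IsRiemannianManifold 𝓘(ℝ, E) M] (p q : M) {a b : ℝ} (ha : 0 < a) (hb : 0 < b)
    (h : dist p q < a + b) : ∃ m, dist p m < a ∧ dist m q < b := by
  obtain ⟨γ, h0, h1, hs, hl⟩ := exists_path_of_dist_lt (E := E) h
  have hc := hs.continuous
  by_contra! hcon
  have key := isPreconnected_Icc (a := (0 : ℝ)) (b := 1) {t | dist p (γ t) < a}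
    {t | dist (γ t) q < b} (isOpen_lt (by fun_prop) (by fun_prop))
    (isOpen_lt (by fun_prop) (by fun_prop)) ?_ ⟨0, by simp, by simp [h0, ha]⟩
    ⟨1, by simp, by simp [h1, hb]⟩
  · obtain ⟨t, -, ht1, ht2⟩ := key
    exact absurd ht2 (not_lt.2 (hcon _ ht1))
  · intro t ht
    by_contra hn
    simp only [mem_union, mem_ofPred_eq, not_or, not_lt] at hn
    have e1 := edist_le_pathELength (E := E) hs ht.1
    have e2 := edist_le_pathELength (E := E) hs ht.2
    rw [h0, edist_dist] at e1
    rw [h1, edist_dist] at e2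
    have := add_le_add e1 e2
    rw [Manifold.pathELength_add ht.1 ht.2, ← ENNReal.ofReal_add dist_nonneg dist_nonneg] at this
    have := this.trans_lt hl
    rw [ENNReal.ofReal_lt_ofReal_iff (by positivity)] at this
    linarith

/-- A `C^1` map whose derivative is bounded by `C` on a metric ball is `C`-Lipschitz with respect
to the centre of the ball. -/
lemma norm_sub_le_of_mfderiv_le {F : Type*} [NormedAddCommGroup F] [NormedSpace ℝ F]
    [CompleteSpace F]
    {f : M → F} {f' : ∀ y : M, TangentSpace 𝓘(ℝ, E) y →L[ℝ] F} {p : M} {δ C : ℝ} (hC0 : 0 ≤ C)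
    (hf1 : ContMDiffOn 𝓘(ℝ, E) 𝓘(ℝ, F) 1 f (Metric.ball p δ))
    (hf : ∀ y ∈ Metric.ball p δ, HasMFDerivAt 𝓘(ℝ, E) 𝓘(ℝ, F) f y (f' y))
    (hC : ∀ y ∈ Metric.ball p δ, ∀ w : TangentSpace 𝓘(ℝ, E) y, ‖f' y w‖ ≤ C * ‖w‖)
    {q : M} (hq : dist p q < δ) : ‖f q - f p‖ ≤ C * dist p q := by
  have main : ∀ r, dist p q < r → r < δ → ‖f q - f p‖ ≤ C * r := by
    intro r hr hrδ
    obtain ⟨γ, h0, h1, hs, hl⟩ := exists_path_of_dist_lt (E := E) hr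
    have hball : ∀ t ∈ Icc (0 : ℝ) 1, γ t ∈ Metric.ball p δ := by
      intro t ht
      have e1 := (edist_le_pathELength (E := E) hs ht.1).trans
        (Manifold.pathELength_mono le_rfl ht.2)
      have e2 := e1.trans_lt hl
      rw [h0, edist_dist, ENNReal.ofReal_lt_ofReal_iff (dist_nonneg.trans_lt hr)] at e2
      rw [Metric.mem_ball']
      exact e2.trans hrδ
    have hC1 : ContDiffOn ℝ 1 (f ∘ γ) (Icc 0 1) := by
      rw [← contMDiffOn_iff_contDiffOn]
      exact hf1.comp hs.contMDiffOn hball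
    have e3 := enorm_sub_le_lintegral_derivWithin_Icc_of_contDiffOn_Icc hC1 zero_le_one
    have e4 : ∫⁻ t in Icc (0 : ℝ) 1, ‖derivWithin (f ∘ γ) (Icc 0 1) t‖ₑ ≤
        ENNReal.ofReal C * Manifold.pathELength 𝓘(ℝ, E) γ 0 1 := by
      rw [Manifold.pathELength_eq_lintegral_mfderiv_Icc,
        ← lintegral_const_mul' _ _ ENNReal.ofReal_ne_top]
      apply setLIntegral_mono' measurableSet_Icc (fun t ht ↦ ?_)
      have hd : HasMFDerivAt 𝓘(ℝ, ℝ) 𝓘(ℝ, F) (f ∘ γ) t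
          ((f' (γ t)).comp (mfderiv 𝓘(ℝ, ℝ) 𝓘(ℝ, E) γ t)) :=
        (hf _ (hball t ht)).comp t ((hs.mdifferentiable one_ne_zero) t).hasMFDerivAt
      have hd2 : HasFDerivAt (f ∘ γ) ((f' (γ t)).comp (mfderiv 𝓘(ℝ, ℝ) 𝓘(ℝ, E) γ t)) t :=
        hasMFDerivAt_iff_hasFDerivAt.1 hd
      have hd3 : derivWithin (f ∘ γ) (Icc 0 1) t =
          f' (γ t) (mfderiv 𝓘(ℝ, ℝ) 𝓘(ℝ, E) γ t 1) :=
        hd2.hasDerivAt.hasDerivWithinAt.derivWithin (uniqueDiffOn_Icc zero_lt_one t ht)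
      rw [hd3, ← ofReal_norm, ← ofReal_norm, ← ENNReal.ofReal_mul hC0]
      exact ENNReal.ofReal_le_ofReal (hC _ (hball t ht) _)
    have e5 := e3.trans (e4.trans (mul_le_mul_right hl.le _))
    rw [← ENNReal.ofReal_mul hC0, ← ofReal_norm] at e5
    have := (ENNReal.ofReal_le_ofReal_iff
      (mul_nonneg hC0 (dist_nonneg.trans hr.le))).1 e5
    simpa [h0, h1] using this
  have hlim : Tendsto (fun r => C * r) (𝓝[>] (dist p q)) (𝓝 (C * dist p q)) :=
    ((continuous_const.mul continuous_id).tendsto _).mono_left nhdsWithin_le_nhds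
  refine ge_of_tendsto hlim ?_
  filter_upwards [Ioo_mem_nhdsGT hq] with r hr using main r hr.1 hr.2

/-- The distance between the endpoints of the image of a segment is bounded by a bound of the
derivative along the segment. -/
lemma dist_le_of_norm_mfderiv_le {ψ : E → M} {ψ' : ∀ a : E, E →L[ℝ] TangentSpace 𝓘(ℝ, E) (ψ a)}
    {U : Set E} {a b : E} {C : ℝ} (hC0 : 0 ≤ C)
    (hU : segment ℝ a b ⊆ U) (hψ1 : ContMDiffOn 𝓘(ℝ, E) 𝓘(ℝ, E) 1 ψ U)
    (hψ : ∀ y ∈ U, HasMFDerivAt 𝓘(ℝ, E) 𝓘(ℝ, E) ψ y (ψ' y))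
    (hC : ∀ y ∈ segment ℝ a b, ‖ψ' y (b - a)‖ ≤ C) : dist (ψ a) (ψ b) ≤ C := by
  let η : ℝ → E := fun t => a + t • (b - a)
  have hη : ∀ t ∈ Icc (0 : ℝ) 1, η t ∈ segment ℝ a b := fun t ht => by
    rw [segment_eq_image']; exact ⟨t, ht, rfl⟩
  have hηs : ContMDiff 𝓘(ℝ, ℝ) 𝓘(ℝ, E) 1 η := by
    rw [contMDiff_iff_contDiff]; fun_prop
  have e1 : edist (ψ a) (ψ b) ≤ Manifold.pathELength 𝓘(ℝ, E) (ψ ∘ η) 0 1 := by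
    rw [IsRiemannianManifold.out (I := 𝓘(ℝ, E))]
    exact Manifold.riemannianEDist_le_pathELength
      (hψ1.comp hηs.contMDiffOn fun t ht => hU (hη t ht)) (by simp [η]) (by simp [η]) zero_le_one
  have e2 : Manifold.pathELength 𝓘(ℝ, E) (ψ ∘ η) 0 1 ≤ ∫⁻ _ in Icc (0 : ℝ) 1, ENNReal.ofReal C := by
    rw [Manifold.pathELength_eq_lintegral_mfderiv_Icc]
    apply setLIntegral_mono' measurableSet_Icc (fun t ht ↦ ?_)
    have hη' : HasFDerivAt η (ContinuousLinearMap.toSpanSingleton ℝ (b - a)) t := by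
      have : HasDerivAt η (b - a) t := by
        simpa [η] using ((hasDerivAt_id' t).smul_const (b - a)).const_add a
      exact this.hasFDerivAt
    have hd : HasMFDerivAt 𝓘(ℝ, ℝ) 𝓘(ℝ, E) (ψ ∘ η) t
        ((ψ' (η t)).comp (ContinuousLinearMap.toSpanSingleton ℝ (b - a))) :=
      (hψ _ (hU (hη t ht))).comp t hη'.hasMFDerivAt
    have : mfderiv 𝓘(ℝ, ℝ) 𝓘(ℝ, E) (ψ ∘ η) t (1 : ℝ) = ψ' (η t) (b - a) := by
      rw [hd.mfderiv]
      change ψ' (η t) ((1 : ℝ) • (b - a)) = _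
      rw [one_smul]
    rw [← ofReal_norm]
    refine ENNReal.ofReal_le_ofReal (le_trans (le_of_eq ?_) (hC _ (hη t ht)))
    exact congrArg norm this
  have e3 := e1.trans e2
  simp only [lintegral_const, MeasurableSet.univ, Measure.restrict_apply, univ_inter,
    Real.volume_Icc, sub_zero, ENNReal.ofReal_one, mul_one] at e3
  rw [edist_dist] at e3
  exact (ENNReal.ofReal_le_ofReal_iff hC0).1 e3

end RiemannianLocal

section ChartMetric

variable {E : Type*} [NormedAddCommGroup E] [NormedSpace ℝ E]
  {M : Type*} [MetricSpace M] [ChartedSpace E M]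
  [Bundle.RiemannianBundle (fun p : M => TangentSpace 𝓘(ℝ, E) p)]

/-- The Riemannian metric read in the chart at `x₀`, as a function of a point and a vector. -/
noncomputable def chartMetric (x₀ : M) (z : E × E) : ℝ :=
  ‖(mfderiv 𝓘(ℝ, E) 𝓘(ℝ, E) (extChartAt 𝓘(ℝ, E) x₀).symm z.1 z.2 :
    TangentSpace 𝓘(ℝ, E) ((extChartAt 𝓘(ℝ, E) x₀).symm z.1))‖ ^ 2

lemma contDiffOn_chartMetric [IsManifold 𝓘(ℝ, E) ∞ M]
    [IsContMDiffRiemannianBundle 𝓘(ℝ, E) ∞ E (fun p : M => TangentSpace 𝓘(ℝ, E) p)] (x₀ : M) :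
    ContDiffOn ℝ ∞ (chartMetric x₀) ((extChartAt 𝓘(ℝ, E) x₀).target ×ˢ univ) := by
  set U := (extChartAt 𝓘(ℝ, E) x₀).target with hU
  have hUo : IsOpen U := isOpen_extChartAt_target x₀
  have h1 : ContMDiffOn 𝓘(ℝ, E) 𝓘(ℝ, E) ∞ (extChartAt 𝓘(ℝ, E) x₀).symm U :=
    contMDiffOn_extChartAt_symm x₀
  have h2 := h1.contMDiffOn_tangentMapWithin (m := ∞) le_rfl hUo.uniqueMDiffOn
  have h3 : ContMDiff (𝓘(ℝ, E).prod 𝓘(ℝ, E)) 𝓘(ℝ, E).tangent ∞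
      (fun z : E × E => (⟨z.1, z.2⟩ : TangentBundle 𝓘(ℝ, E) E)) := by
    intro z
    rw [Bundle.contMDiffAt_totalSpace]
    refine ⟨contMDiffAt_fst, ?_⟩
    simpa using contMDiffAt_snd
  have h4 := h2.comp (s := U ×ˢ univ) h3.contMDiffOn (fun z hz => hz.1)
  have h5 : ContMDiffOn (𝓘(ℝ, E).prod 𝓘(ℝ, E)) 𝓘(ℝ, E).tangent ∞
      (fun z : E × E => (⟨(extChartAt 𝓘(ℝ, E) x₀).symm z.1,
        mfderiv 𝓘(ℝ, E) 𝓘(ℝ, E) (extChartAt 𝓘(ℝ, E) x₀).symm z.1 z.2⟩ : TangentBundle 𝓘(ℝ, E) M))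
      (U ×ˢ univ) := by
    refine h4.congr fun z hz => ?_
    simp only [Function.comp, tangentMapWithin]
    rw [mfderivWithin_of_mem_nhds (hUo.mem_nhds hz.1)]
  have h6 := ContMDiffOn.inner_bundle (IB := 𝓘(ℝ, E)) (F := E)
    (E := fun p : M => TangentSpace 𝓘(ℝ, E) p)
    (b := fun z : E × E => (extChartAt 𝓘(ℝ, E) x₀).symm z.1) h5 h5
  have h7 : ContDiffOn ℝ ∞ (fun z : E × E => inner ℝ
      (mfderiv 𝓘(ℝ, E) 𝓘(ℝ, E) (extChartAt 𝓘(ℝ, E) x₀).symm z.1 z.2)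
      (mfderiv 𝓘(ℝ, E) 𝓘(ℝ, E) (extChartAt 𝓘(ℝ, E) x₀).symm z.1 z.2)) (U ×ˢ univ) := by
    rw [← contMDiffOn_iff_contDiffOn, modelWithCornersSelf_prod, ← chartedSpaceSelf_prod]
    exact h6
  refine h7.congr fun z hz => ?_
  exact (real_inner_self_eq_norm_sq _).symm
end ChartMetric

/-- A local description of a metric `dist` around `x₀` by a chart `φ` with inverse `ψ` in which the
squared distance of nearby points is, up to a small multiple of the squared coordinate distance,
the value of a `C^2` function `Q` that is a positive quadratic form in its second argument. -/
structure IsLocalMetricModel {E M : Type*} [NormedAddCommGroup E] [NormedSpace ℝ E] [MetricSpace M]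
    (x₀ : M) (φ : M → E) (ψ : E → M) (Q : E × E → ℝ) (r C lam : ℝ) : Prop where
  r_pos : 0 < r
  C_pos : 0 < C
  lam_pos : 0 < lam
  contDiffAt : ContDiffAt ℝ 2 Q (φ x₀, 0)
  map_smul : ∀ y (s : ℝ) v, Q (y, s • v) = s ^ 2 * Q (y, v)
  le_apply : ∀ w, lam * ‖w‖ ^ 2 ≤ Q (φ x₀, w)
  left_inv : ∀ p ∈ Metric.ball x₀ r, ψ (φ p) = p
  norm_sub_le : ∀ p ∈ Metric.ball x₀ r, ∀ q ∈ Metric.ball x₀ r, ‖φ p - φ q‖ ≤ C * dist p q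
  abs_sub_le : ∀ ε > 0, ∃ ρ > 0, ∀ a ∈ Metric.ball (φ x₀) r, ∀ b ∈ Metric.ball (φ x₀) r,
    ‖b - a‖ < ρ → |dist (ψ a) (ψ b) ^ 2 - Q (a, b - a)| ≤ ε * ‖b - a‖ ^ 2

section ChartMetric

variable {E : Type*} [NormedAddCommGroup E] [NormedSpace ℝ E]
  {M : Type*} [MetricSpace M] [ChartedSpace E M]
  [Bundle.RiemannianBundle (fun p : M => TangentSpace 𝓘(ℝ, E) p)]

lemma chartMetric_smul (x₀ : M) (y : E) (s : ℝ) (v : E) :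
    chartMetric x₀ (y, s • v) = s ^ 2 * chartMetric x₀ (y, v) := by
  have : mfderiv 𝓘(ℝ, E) 𝓘(ℝ, E) (extChartAt 𝓘(ℝ, E) x₀).symm y (s • v) =
    s • mfderiv 𝓘(ℝ, E) 𝓘(ℝ, E) (extChartAt 𝓘(ℝ, E) x₀).symm y v :=
    (mfderiv 𝓘(ℝ, E) 𝓘(ℝ, E) (extChartAt 𝓘(ℝ, E) x₀).symm y).map_smul s v
  simp only [chartMetric]
  rw [this, norm_smul, mul_pow, Real.norm_eq_abs, sq_abs]

lemma hasMFDerivAt_chart_symm {E : Type*} [NormedAddCommGroup E] [NormedSpace ℝ E]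
    {M : Type*} [MetricSpace M] [ChartedSpace E M] [IsManifold 𝓘(ℝ, E) ∞ M] (x₀ : M) {y : E}
    (hy : y ∈ (extChartAt 𝓘(ℝ, E) x₀).target) :
    HasMFDerivAt 𝓘(ℝ, E) 𝓘(ℝ, E) (extChartAt 𝓘(ℝ, E) x₀).symm y
      (mfderiv 𝓘(ℝ, E) 𝓘(ℝ, E) (extChartAt 𝓘(ℝ, E) x₀).symm y) := by
  have h := (contMDiffOn_extChartAt_symm (n := ∞) (I := 𝓘(ℝ, E)) x₀).contMDiffAt
    ((isOpen_extChartAt_target x₀).mem_nhds hy)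
  exact (h.mdifferentiableAt (by simp)).hasMFDerivAt

lemma hasMFDerivAt_chart {E : Type*} [NormedAddCommGroup E] [NormedSpace ℝ E]
    {M : Type*} [MetricSpace M] [ChartedSpace E M] [IsManifold 𝓘(ℝ, E) ∞ M] (x₀ : M) {p : M}
    (hp : p ∈ (extChartAt 𝓘(ℝ, E) x₀).source) :
    HasMFDerivAt 𝓘(ℝ, E) 𝓘(ℝ, E) (extChartAt 𝓘(ℝ, E) x₀) p
      (mfderiv 𝓘(ℝ, E) 𝓘(ℝ, E) (extChartAt 𝓘(ℝ, E) x₀) p) :=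
  (mdifferentiableAt_extChartAt (by simpa using hp)).hasMFDerivAt

lemma mfderiv_chart_symm_mfderiv_chart [IsManifold 𝓘(ℝ, E) ∞ M] (x₀ : M) {p : M}
    (hp : p ∈ (extChartAt 𝓘(ℝ, E) x₀).source) (w : TangentSpace 𝓘(ℝ, E) p) :
    chartMetric x₀ (extChartAt 𝓘(ℝ, E) x₀ p, mfderiv 𝓘(ℝ, E) 𝓘(ℝ, E) (extChartAt 𝓘(ℝ, E) x₀) p w)
      = ‖w‖ ^ 2 := by
  set φ := extChartAt 𝓘(ℝ, E) x₀ with hφ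
  have h1 := (hasMFDerivAt_chart_symm x₀ (φ.map_source hp)).comp p (hasMFDerivAt_chart x₀ hp)
  have h2 : HasMFDerivAt 𝓘(ℝ, E) 𝓘(ℝ, E) (φ.symm ∘ φ) p
      (ContinuousLinearMap.id ℝ (TangentSpace 𝓘(ℝ, E) p)) := by
    refine (hasMFDerivAt_id p).congr_of_eventuallyEq ?_
    filter_upwards [(isOpen_extChartAt_source (I := 𝓘(ℝ, E)) x₀).mem_nhds hp] with q hq
    exact φ.left_inv hq
  have h3 := hasMFDerivAt_unique h1 h2
  have h4 := congrArg (fun T => T w) h3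
  simp only [chartMetric]
  have key : ∀ (q : M) (hq : q = p) (u : TangentSpace 𝓘(ℝ, E) q),
      @Eq E u w → ‖u‖ = ‖w‖ := by
    rintro q rfl u rfl; rfl
  exact congrArg (· ^ 2) (key _ (φ.left_inv hp) _ h4)

lemma chartMetric_pos [IsManifold 𝓘(ℝ, E) ∞ M] (x₀ : M) {y : E}
    (hy : y ∈ (extChartAt 𝓘(ℝ, E) x₀).target) {w : E} (hw : w ≠ 0) :
    0 < chartMetric x₀ (y, w) := by
  set φ := extChartAt 𝓘(ℝ, E) x₀ with hφ
  have h1 : HasMFDerivAt 𝓘(ℝ, E) 𝓘(ℝ, E) φ (φ.symm y) 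
     (mfderiv 𝓘(ℝ, E) 𝓘(ℝ, E) φ (φ.symm y)) := (hasMFDerivAt_chart x₀ (φ.map_target hy))
  have h1 := h1.comp y (hasMFDerivAt_chart_symm x₀ hy)
  have h2 : HasMFDerivAt 𝓘(ℝ, E) 𝓘(ℝ, E) (φ ∘ φ.symm) y
      (ContinuousLinearMap.id ℝ E) := by
    refine (hasMFDerivAt_id y).congr_of_eventuallyEq ?_
    filter_upwards [(isOpen_extChartAt_target x₀).mem_nhds hy] with q hq
    exact φ.right_inv hq
  have h3 := hasMFDerivAt_unique h1 h2
  have h4 : mfderiv 𝓘(ℝ, E) 𝓘(ℝ, E) φ (φ.symm y) (mfderiv 𝓘(ℝ, E) 𝓘(ℝ, E) φ.symm y w) = w :=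
    congrArg (fun T => T w) h3
  simp only [chartMetric]
  refine pow_pos (norm_pos_iff.2 fun h => hw ?_) 2
  rw [← h4, h, map_zero]
  rfl

lemma exists_pos_mul_le_chartMetric [IsManifold 𝓘(ℝ, E) ∞ M]
    [IsContMDiffRiemannianBundle 𝓘(ℝ, E) ∞ E (fun p : M => TangentSpace 𝓘(ℝ, E) p)]
    (x₀ : M) {K : Set E} (hK : IsCompact (K ×ˢ Metric.sphere (0 : E) 1))
    (hKt : K ⊆ (extChartAt 𝓘(ℝ, E) x₀).target) :
    ∃ lam > 0, ∀ y ∈ K, ∀ w, lam * ‖w‖ ^ 2 ≤ chartMetric x₀ (y, w) := by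
  have hc : ContinuousOn (chartMetric x₀) (K ×ˢ Metric.sphere (0 : E) 1) :=
    (contDiffOn_chartMetric x₀).continuousOn.mono (prod_mono hKt (subset_univ _))
  obtain ⟨lam, h0, h1⟩ := hK.exists_forall_le' hc (a := 0) (fun z hz => 
    chartMetric_pos x₀ (hKt hz.1) (by rintro h; simpa [h] using hz.2))
  refine ⟨lam, h0, fun y hy w => ?_⟩
  rcases eq_or_ne w 0 with rfl | hw
  · have := chartMetric_smul x₀ y 0 0
    simp at this
    simp [this]
  have hw' : ‖w‖ ≠ 0 := norm_ne_zero_iff.2 hw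
  have h2 := h1 (y, ‖w‖⁻¹ • w) ⟨hy, by simp [norm_smul, hw']⟩
  rw [chartMetric_smul, inv_pow, inv_mul_eq_div, le_div_iff₀ (by positivity)] at h2
  exact h2

lemma exists_chartMetric_le_mul [IsManifold 𝓘(ℝ, E) ∞ M]
    [IsContMDiffRiemannianBundle 𝓘(ℝ, E) ∞ E (fun p : M => TangentSpace 𝓘(ℝ, E) p)]
    (x₀ : M) {K : Set E} (hK : IsCompact (K ×ˢ Metric.sphere (0 : E) 1))
    (hKt : K ⊆ (extChartAt 𝓘(ℝ, E) x₀).target) :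
    ∃ Λ > 0, ∀ y ∈ K, ∀ w, chartMetric x₀ (y, w) ≤ Λ * ‖w‖ ^ 2 := by
  have hc : ContinuousOn (chartMetric x₀) (K ×ˢ Metric.sphere (0 : E) 1) :=
    (contDiffOn_chartMetric x₀).continuousOn.mono (prod_mono hKt (subset_univ _))
  obtain ⟨B, hB⟩ := hK.bddAbove_image hc
  refine ⟨max B 1, by positivity, fun y hy w => ?_⟩
  rcases eq_or_ne w 0 with rfl | hw
  · have := chartMetric_smul x₀ y 0 0
    simp at this
    simp [this]
  have hw' : ‖w‖ ≠ 0 := norm_ne_zero_iff.2 hw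
  have hm : (y, ‖w‖⁻¹ • w) ∈ K ×ˢ Metric.sphere (0 : E) 1 := ⟨hy, by simp [norm_smul, hw']⟩
  have h2 := (hB (mem_image_of_mem _ hm)).trans (le_max_left B 1)
  rw [chartMetric_smul, inv_pow, inv_mul_eq_div, div_le_iff₀ (by positivity)] at h2
  exact h2

lemma exists_abs_chartMetric_sub_le [IsManifold 𝓘(ℝ, E) ∞ M]
    [IsContMDiffRiemannianBundle 𝓘(ℝ, E) ∞ E (fun p : M => TangentSpace 𝓘(ℝ, E) p)]
    (x₀ : M) {K : Set E} (hK : IsCompact (K ×ˢ Metric.sphere (0 : E) 1))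
    (hKt : K ⊆ (extChartAt 𝓘(ℝ, E) x₀).target) {ε : ℝ} (hε : 0 < ε) :
    ∃ ρ > 0, ∀ y ∈ K, ∀ y' ∈ K, ‖y - y'‖ < ρ → ∀ w,
      |chartMetric x₀ (y, w) - chartMetric x₀ (y', w)| ≤ ε * ‖w‖ ^ 2 := by
  have hc : ContinuousOn (chartMetric x₀) (K ×ˢ Metric.sphere (0 : E) 1) :=
    (contDiffOn_chartMetric x₀).continuousOn.mono (prod_mono hKt (subset_univ _))
  have hu := hK.uniformContinuousOn_of_continuous hc
  obtain ⟨ρ, hρ, h⟩ := Metric.uniformContinuousOn_iff.1 hu ε hε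
  refine ⟨ρ, hρ, fun y hy y' hy' hyy w => ?_⟩
  rcases eq_or_ne w 0 with rfl | hw
  · have h1 := chartMetric_smul x₀ y 0 0
    have h2 := chartMetric_smul x₀ y' 0 0
    simp at h1 h2
    simp [h1, h2]
  have hw' : ‖w‖ ≠ 0 := norm_ne_zero_iff.2 hw
  have hs : ‖w‖⁻¹ • w ∈ Metric.sphere (0 : E) 1 := by simp [norm_smul, hw']
  have h2 := (h (y, ‖w‖⁻¹ • w) ⟨hy, hs⟩ (y', ‖w‖⁻¹ • w) ⟨hy', hs⟩
    (by simpa [Prod.dist_eq, dist_eq_norm, hρ] using hyy)).le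
  rw [Real.dist_eq, chartMetric_smul, chartMetric_smul, ← mul_sub, abs_mul, inv_pow,
    abs_of_nonneg (by positivity), inv_mul_eq_div, div_le_iff₀ (by positivity)] at h2
  exact h2

end ChartMetric

section LocalModel

variable {E : Type*} [NormedAddCommGroup E] [NormedSpace ℝ E] [FiniteDimensional ℝ E]
  {M : Type*} [MetricSpace M] [ChartedSpace E M] [IsManifold 𝓘(ℝ, E) ∞ M]
  [Bundle.RiemannianBundle (fun p : M => TangentSpace 𝓘(ℝ, E) p)]
  [IsRiemannianManifold 𝓘(ℝ, E) M]

/-- In a chart of a Riemannian manifold, the distance dominates the coordinate norm frozen at a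
point, up to a factor close to one. -/
lemma chartMetric_le_mul_dist_sq (x₀ : M) {p q : M} {δ κ : ℝ} (hκ : 0 ≤ κ)
    (hball : Metric.ball p δ ⊆ (extChartAt 𝓘(ℝ, E) x₀).source)
    (hQ : ∀ y ∈ Metric.ball p δ, ∀ w, chartMetric x₀ (extChartAt 𝓘(ℝ, E) x₀ p, w) ≤
      κ * chartMetric x₀ (extChartAt 𝓘(ℝ, E) x₀ y, w)) (hq : dist p q < δ) :
    chartMetric x₀ (extChartAt 𝓘(ℝ, E) x₀ p, extChartAt 𝓘(ℝ, E) x₀ q - extChartAt 𝓘(ℝ, E) x₀ p)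
      ≤ κ * dist p q ^ 2 := by
  set φ := extChartAt 𝓘(ℝ, E) x₀ with hφ
  let F := TangentSpace 𝓘(ℝ, E) (φ.symm (φ p))
  have : FiniteDimensional ℝ F := inferInstanceAs (FiniteDimensional ℝ E)
  have : CompleteSpace F := FiniteDimensional.complete ℝ F
  let T : E →L[ℝ] F := mfderiv 𝓘(ℝ, E) 𝓘(ℝ, E) φ.symm (φ p)
  have hT : ∀ w, ‖T w‖ ^ 2 = chartMetric x₀ (φ p, w) := fun w => rfl
  have hsm : ContMDiffOn 𝓘(ℝ, E) 𝓘(ℝ, E) 1 φ (Metric.ball p δ) := by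
    refine (contMDiffOn_extChartAt (I := 𝓘(ℝ, E)) (n := 1) (x := x₀)).mono ?_
    simpa [hφ] using hball
  have hTs : ContMDiff 𝓘(ℝ, E) 𝓘(ℝ, F) 1 T := by
    rw [contMDiff_iff_contDiff]; exact T.contDiff
  have key := norm_sub_le_of_mfderiv_le (E := E) (F := F) (f := T ∘ φ) (p := p) (q := q)
    (f' := fun y => T.comp (mfderiv 𝓘(ℝ, E) 𝓘(ℝ, E) φ y)) (δ := δ) (C := √κ) (Real.sqrt_nonneg _)
    (hTs.comp_contMDiffOn hsm) (fun y hy => ?_) (fun y hy w => ?_) hq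
  · have := pow_le_pow_left₀ (norm_nonneg _) key 2
    rw [mul_pow, Real.sq_sqrt hκ] at this
    simpa only [Function.comp, ← map_sub, hT] using this
  · have hTd : HasMFDerivAt 𝓘(ℝ, E) 𝓘(ℝ, F) T (φ y) T :=
      hasMFDerivAt_iff_hasFDerivAt.2 T.hasFDerivAt
    exact HasMFDerivAt.comp (I'' := 𝓘(ℝ, F)) y hTd (hasMFDerivAt_chart x₀ (hball hy))
  · have h1 := hQ y hy (mfderiv 𝓘(ℝ, E) 𝓘(ℝ, E) φ y w)
    rw [mfderiv_chart_symm_mfderiv_chart x₀ (hball hy) w] at h1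
    refine le_of_sq_le_sq ?_ (by positivity)
    rw [mul_pow, Real.sq_sqrt hκ]
    exact h1

/-- In a chart of a Riemannian manifold, the distance is bounded by the coordinate length of
segments. -/
lemma dist_sq_le_of_chartMetric_le {E : Type*} [NormedAddCommGroup E] [NormedSpace ℝ E]
    {M : Type*} [MetricSpace M] [ChartedSpace E M] [IsManifold 𝓘(ℝ, E) ∞ M]
    [Bundle.RiemannianBundle (fun p : M => TangentSpace 𝓘(ℝ, E) p)]
    [IsRiemannianManifold 𝓘(ℝ, E) M] (x₀ : M) {a b : E} {C : ℝ} (hC0 : 0 ≤ C)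
    (hs : segment ℝ a b ⊆ (extChartAt 𝓘(ℝ, E) x₀).target)
    (hC : ∀ y ∈ segment ℝ a b, chartMetric x₀ (y, b - a) ≤ C) :
    dist ((extChartAt 𝓘(ℝ, E) x₀).symm a) ((extChartAt 𝓘(ℝ, E) x₀).symm b) ^ 2 ≤ C := by
  have := dist_le_of_norm_mfderiv_le (E := E) (C := √C) (Real.sqrt_nonneg _) hs
    (contMDiffOn_extChartAt_symm x₀) (fun y hy => hasMFDerivAt_chart_symm x₀ hy) (fun y hy => ?_)
  · have h := pow_le_pow_left₀ dist_nonneg this 2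
    rwa [Real.sq_sqrt hC0] at h
  · exact Real.le_sqrt_of_sq_le (hC y hy)

theorem exists_isLocalMetricModel
    [IsContMDiffRiemannianBundle 𝓘(ℝ, E) ∞ E (fun p : M => TangentSpace 𝓘(ℝ, E) p)] (x₀ : M) :
    ∃ (φ : M → E) (ψ : E → M) (Q : E × E → ℝ) (r C lam : ℝ),
      IsLocalMetricModel x₀ φ ψ Q r C lam := by
  set φ := extChartAt 𝓘(ℝ, E) x₀ with hφ
  have hUo : IsOpen φ.target := isOpen_extChartAt_target x₀
  have hSo : IsOpen φ.source := isOpen_extChartAt_source x₀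
  have hz : φ x₀ ∈ φ.target := mem_extChartAt_target x₀
  have hφc : ContinuousAt φ x₀ := continuousAt_extChartAt x₀
  have hψc : ContinuousAt φ.symm (φ x₀) := continuousAt_extChartAt_symm x₀
  obtain ⟨r₁, hr₁, hK⟩ : ∃ r₁ > 0, Metric.closedBall (φ x₀) r₁ ⊆ φ.target :=
    Metric.nhds_basis_closedBall.mem_iff.1 (hUo.mem_nhds hz)
  set K := Metric.closedBall (φ x₀) r₁ with hKdef
  have hKc : IsCompact (K ×ˢ Metric.sphere (0 : E) 1) :=
    have := FiniteDimensional.proper ℝ E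
    (isCompact_closedBall _ _).prod (isCompact_sphere _ _)
  obtain ⟨lam, hlam, hlow⟩ := exists_pos_mul_le_chartMetric x₀ hKc hK
  obtain ⟨Λ, hΛ, hup⟩ := exists_chartMetric_le_mul x₀ hKc hK
  obtain ⟨r₂, hr₂, hB⟩ : ∃ r₂ > 0, Metric.ball x₀ r₂ ⊆ φ.source ∩ φ ⁻¹' K :=
    Metric.mem_nhds_iff.1 (inter_mem (hSo.mem_nhds (mem_extChartAt_source x₀))
      (hφc (Metric.closedBall_mem_nhds _ hr₁)))
  -- the chart is Lipschitz
  have hLip : ∀ p ∈ Metric.ball x₀ (r₂ / 4), ∀ q ∈ Metric.ball x₀ (r₂ / 4),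
      ‖φ p - φ q‖ ≤ √(Λ / lam / lam) * dist p q := by
    intro p hp q hq
    rw [Metric.mem_ball] at hp hq
    have hsub : Metric.ball p (r₂ / 2) ⊆ Metric.ball x₀ r₂ :=
      Metric.ball_subset_ball' (by linarith)
    have hpB := hB (Metric.mem_ball.2 (by linarith : dist p x₀ < r₂))
    have h1 := chartMetric_le_mul_dist_sq x₀ (κ := Λ / lam) (by positivity)
      (hsub.trans (hB.trans inter_subset_left)) (q := q) (fun y hy w => ?_)
      (by linarith [dist_triangle_right p q x₀])
    · have h2 := hlow _ hpB.2 (φ q - φ p)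
      refine le_of_sq_le_sq ?_ (by positivity)
      rw [mul_pow, Real.sq_sqrt (by positivity), norm_sub_rev]
      rw [div_mul_eq_mul_div, le_div_iff₀ hlam]
      linarith
    · have h3 := hup _ hpB.2 w
      have h4 := hlow _ (hB (hsub hy)).2 w
      rw [div_mul_eq_mul_div, le_div_iff₀ hlam]
      calc _ ≤ Λ * ‖w‖ ^ 2 * lam := by gcongr
        _ = Λ * (lam * ‖w‖ ^ 2) := by ring
        _ ≤ _ := by gcongr
  set C := √(Λ / lam / lam) with hC
  have hC0 : 0 < C := Real.sqrt_pos.2 (by positivity)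
  obtain ⟨r₃, hr₃, hψB⟩ : ∃ r₃ > 0, Metric.ball (φ x₀) r₃ ⊆ φ.symm ⁻¹' Metric.ball x₀ (r₂ / 8) := by
    refine Metric.mem_nhds_iff.1 (hψc ?_)
    rw [extChartAt_to_inv]
    exact Metric.ball_mem_nhds _ (by positivity)
  refine ⟨φ, φ.symm, chartMetric x₀, min (r₂ / 4) (min r₁ r₃), C, lam, by positivity, hC0, hlam,
    ?_, chartMetric_smul x₀, hlow _ (Metric.mem_closedBall_self hr₁.le), ?_, ?_, ?_⟩
  · refine ((contDiffOn_chartMetric x₀).contDiffAt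
      ((hUo.prod isOpen_univ).mem_nhds ⟨hz, trivial⟩)).of_le ?_
    exact ENat.LEInfty.out
  · intro p hp
    have hp' : p ∈ Metric.ball x₀ r₂ :=
      Metric.ball_subset_ball ((min_le_left _ _).trans (by linarith)) hp
    exact φ.left_inv (hB hp').1
  · intro p hp q hq
    exact hLip p (Metric.ball_subset_ball (min_le_left _ _) hp) q
      (Metric.ball_subset_ball (min_le_left _ _) hq)
  · intro ε hε
    set η := ε / Λ with hη
    have hη0 : 0 < η := by positivity
    obtain ⟨ρ₁, hρ₁, hunif⟩ := exists_abs_chartMetric_sub_le x₀ hKc hK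
      (ε := min ε (lam * η)) (by positivity)
    set δ := min (r₂ / 8) (ρ₁ / C) with hδ
    have hδ0 : 0 < δ := by positivity
    refine ⟨min ρ₁ (δ / √Λ), by positivity, fun a ha b hb hab => ?_⟩
    have hsegK : segment ℝ a b ⊆ K := by
      refine (convex_closedBall _ _).segment_subset ?_ ?_
      · exact Metric.ball_subset_closedBall
          (Metric.ball_subset_ball ((min_le_right _ _).trans (min_le_left _ _)) ha)
      · exact Metric.ball_subset_closedBall
          (Metric.ball_subset_ball ((min_le_right _ _).trans (min_le_left _ _)) hb)
    have haK : a ∈ K := hsegK (left_mem_segment ℝ a b)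
    have hbK : b ∈ K := hsegK (right_mem_segment ℝ a b)
    have hψa : φ.symm a ∈ Metric.ball x₀ (r₂ / 8) :=
      hψB (Metric.ball_subset_ball ((min_le_right _ _).trans (min_le_right _ _)) ha)
    have hQ0 : ∀ y ∈ K, ∀ w, 0 ≤ chartMetric x₀ (y, w) := fun y hy w => sq_nonneg _
    have hupper : dist (φ.symm a) (φ.symm b) ^ 2 ≤ chartMetric x₀ (a, b - a) + ε * ‖b - a‖ ^ 2 := by
      refine dist_sq_le_of_chartMetric_le x₀ (by have := hQ0 a haK (b - a); positivity)
        (hsegK.trans hK) (fun y hy => ?_)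
      have h1 : ‖y - a‖ < ρ₁ :=
        ((norm_sub_le_of_mem_segment hy)).trans_lt (hab.trans_le (min_le_left _ _))
      have h2 := (abs_le.1 (hunif y (hsegK hy) a haK h1 (b - a))).2
      have h3 : min ε (lam * η) * ‖b - a‖ ^ 2 ≤ ε * ‖b - a‖ ^ 2 := by gcongr; exact min_le_left _ _
      linarith
    have hcrude : dist (φ.symm a) (φ.symm b) ^ 2 ≤ Λ * ‖b - a‖ ^ 2 :=
      dist_sq_le_of_chartMetric_le x₀ (by positivity) (hsegK.trans hK)
        (fun y hy => hup y (hsegK hy) _)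
    have hlt : dist (φ.symm a) (φ.symm b) < δ := by
      refine lt_of_pow_lt_pow_left₀ 2 hδ0.le (hcrude.trans_lt ?_)
      have h1 := (lt_div_iff₀ (Real.sqrt_pos.2 hΛ)).1 (hab.trans_le (min_le_right _ _))
      have h2 := pow_lt_pow_left₀ h1 (by positivity) two_ne_zero
      rw [mul_pow, Real.sq_sqrt hΛ.le] at h2
      linarith
    have hball : Metric.ball (φ.symm a) δ ⊆ Metric.ball x₀ (r₂ / 4) := by
      refine Metric.ball_subset_ball' ?_
      have := min_le_left (r₂ / 8) (ρ₁ / C)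
      rw [Metric.mem_ball] at hψa
      linarith
    have hball' : Metric.ball x₀ (r₂ / 4) ⊆ Metric.ball x₀ r₂ :=
      Metric.ball_subset_ball (by linarith)
    have hlower := chartMetric_le_mul_dist_sq x₀ (κ := 1 + η) (by positivity)
      ((hball.trans hball').trans (hB.trans inter_subset_left))
      (fun y hy w => ?_) hlt
    · rw [φ.right_inv (hK haK), φ.right_inv (hK hbK)] at hlower
      have h1 : η * dist (φ.symm a) (φ.symm b) ^ 2 ≤ ε * ‖b - a‖ ^ 2 := by
        calc _ ≤ η * (Λ * ‖b - a‖ ^ 2) := by gcongr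
          _ = _ := by rw [hη]; field_simp
      rw [abs_le]
      constructor <;> linarith
    · rw [φ.right_inv (hK haK)]
      have hy' := hball hy
      have h1 : ‖a - φ y‖ < ρ₁ := by
        have h2 := hLip _ (Metric.ball_subset_ball (by linarith) hψa) y hy'
        rw [φ.right_inv (hK haK)] at h2
        refine h2.trans_lt ?_
        rw [Metric.mem_ball'] at hy
        have h3 := hy.trans_le (min_le_right _ _)
        rw [lt_div_iff₀ hC0] at h3
        linarith
      have h2 := (abs_le.1 (hunif a haK (φ y) (hB (hball' hy')).2 h1 w)).2
      have h3 := hlow (φ y) (hB (hball' hy')).2 w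
      have h4 : min ε (lam * η) * ‖w‖ ^ 2 ≤ η * (lam * ‖w‖ ^ 2) := by
        rw [← mul_assoc, mul_comm η]; gcongr; exact min_le_right _ _
      have h5 := mul_le_mul_of_nonneg_left h3 hη0.le
      linarith

end LocalModel

section SecondDifference

variable {G : Type*} [NormedAddCommGroup G] [NormedSpace ℝ G]

/-- Second differences of a `C^2` function are approximated, uniformly in the centre, by the second
derivative at a point. -/
lemma exists_abs_second_difference_sub_le {Q : G → ℝ} {z : G} (hQ : ContDiffAt ℝ 2 Q z) :
    ∃ T : G →L[ℝ] G →L[ℝ] ℝ, ∀ ε > 0, ∃ δ > 0, ∀ m k : G, m + k ∈ Metric.ball z δ →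
      m - k ∈ Metric.ball z δ → |Q (m + k) + Q (m - k) - 2 * Q m - T k k| ≤ ε * ‖k‖ ^ 2 := by
  have hD : ContDiffAt ℝ 1 (fderiv ℝ Q) z := hQ.fderiv_right (by norm_num)
  have hs := hD.hasStrictFDerivAt one_ne_zero
  refine ⟨fderiv ℝ (fderiv ℝ Q) z, fun ε hε => ?_⟩
  set T := fderiv ℝ (fderiv ℝ Q) z with hT
  have h1 : ∀ᶠ p : G × G in 𝓝 (z, z),
      ‖fderiv ℝ Q p.1 - fderiv ℝ Q p.2 - T (p.1 - p.2)‖ ≤ (ε / 2) * ‖p.1 - p.2‖ :=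
    hs.isLittleO.def (by positivity)
  have h2 : ∀ᶠ p in 𝓝 z, DifferentiableAt ℝ Q p := by
    filter_upwards [hQ.eventually (by simp)] with p hp using hp.differentiableAt (by simp)
  rw [nhds_prod_eq, (Metric.nhds_basis_ball.prod_self).eventually_iff] at h1
  rw [Metric.nhds_basis_ball.eventually_iff] at h2
  obtain ⟨δ₁, hδ₁, h1⟩ := h1
  obtain ⟨δ₂, hδ₂, h2⟩ := h2
  refine ⟨min δ₁ δ₂, by positivity, fun m k hp hm => ?_⟩
  have hseg : ∀ s ∈ Icc (-1 : ℝ) 1, m + s • k ∈ Metric.ball z (min δ₁ δ₂) := by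
    intro s hs
    have := (convex_ball z (min δ₁ δ₂)) hp hm (a := (1 + s) / 2) (b := (1 - s) / 2)
      (by linarith [hs.1]) (by linarith [hs.2]) (by ring)
    convert this using 1
    module
  let g : ℝ → ℝ := fun s => Q (m + s • k) + Q (m + (-s) • k) - s ^ 2 * T k k
  have hderiv : ∀ s ∈ Icc (0 : ℝ) 1, HasDerivWithinAt g (fderiv ℝ Q (m + s • k) k -
      fderiv ℝ Q (m + (-s) • k) k - 2 * s * T k k) (Icc 0 1) s := by
    intro s hs
    have a1 : HasDerivAt (fun s : ℝ => m + s • k) k s := by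
      simpa using ((hasDerivAt_id' s).smul_const k).const_add m
    have a2 : HasDerivAt (fun s : ℝ => m + (-s) • k) (-k) s := by
      simpa using ((hasDerivAt_id' s).neg.smul_const k).const_add m
    have b1 := (h2 (Metric.ball_subset_ball (min_le_right _ _)
      (hseg s ⟨by linarith [hs.1], hs.2⟩))).hasFDerivAt.comp_hasDerivAt s a1
    have b2 := (h2 (Metric.ball_subset_ball (min_le_right _ _)
      (hseg (-s) ⟨by linarith [hs.2], by linarith [hs.1]⟩))).hasFDerivAt.comp_hasDerivAt s a2
    have b3 := ((hasDerivAt_id' s).pow 2).mul_const (T k k)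
    refine HasDerivAt.hasDerivWithinAt ?_
    convert! (b1.add b2).sub b3 using 1
    simp [sub_eq_add_neg]
  have hbound : ∀ s ∈ Ico (0 : ℝ) 1, ‖fderiv ℝ Q (m + s • k) k -
      fderiv ℝ Q (m + (-s) • k) k - 2 * s * T k k‖ ≤ ε * ‖k‖ ^ 2 := by
    intro s hs
    have c1 := @h1 (m + s • k, m + (-s) • k) ⟨Metric.ball_subset_ball (min_le_left _ _)
      (hseg s ⟨by linarith [hs.1], hs.2.le⟩), Metric.ball_subset_ball (min_le_left _ _)
      (hseg (-s) ⟨by linarith [hs.2], by linarith [hs.1]⟩)⟩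
    have c2 : m + s • k - (m + (-s) • k) = (2 * s) • k := by module
    simp only [c2] at c1
    have c3 := (ContinuousLinearMap.le_opNorm (fderiv ℝ Q (m + s • k) -
      fderiv ℝ Q (m + (-s) • k) - T ((2 * s) • k)) k)
    simp only [sub_apply, map_smul, smul_apply,
      smul_eq_mul] at c3
    refine c3.trans ?_
    rw [map_smul] at c1
    refine (mul_le_mul_of_nonneg_right c1 (norm_nonneg k)).trans ?_
    rw [norm_smul, Real.norm_eq_abs, abs_of_nonneg (by linarith [hs.1])]
    have : s ≤ 1 := hs.2.le
    calc ε / 2 * (2 * s * ‖k‖) * ‖k‖ = s * (ε * ‖k‖ ^ 2) := by ring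
      _ ≤ 1 * (ε * ‖k‖ ^ 2) := by gcongr
      _ = _ := one_mul _
  have := norm_image_sub_le_of_norm_deriv_le_segment_01' hderiv hbound
  simp only [g, one_smul, neg_smul, zero_smul, neg_zero, add_zero, one_pow, one_mul,
    Real.norm_eq_abs] at this
  simp only [← sub_eq_add_neg] at this
  convert this using 2
  ring

end SecondDifference

section QuadraticModel

variable {E : Type*} [NormedAddCommGroup E] [NormedSpace ℝ E]

/-- A `C^2` function that is quadratic in its second argument is almost convex near the zero
section. -/
lemma exists_mul_sq_sub_le_second_difference {Q : E × E → ℝ} {z : E} {lam : ℝ} (hlam : 0 < lam)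
    (hQ : ContDiffAt ℝ 2 Q (z, 0)) (hsmul : ∀ y (s : ℝ) v, Q (y, s • v) = s ^ 2 * Q (y, v))
    (hlow : ∀ w, lam * ‖w‖ ^ 2 ≤ Q (z, w)) :
    ∃ δ > 0, ∀ x h v w : E, ‖x + h - z‖ < δ → ‖x - h - z‖ < δ → ‖v + w‖ < δ → ‖v - w‖ < δ →
      lam * ‖w‖ ^ 2 - lam / 2 * ‖h‖ ^ 2 ≤
        Q (x + h, v + w) + Q (x - h, v - w) - 2 * Q (x, v) := by
  obtain ⟨T, hT⟩ := exists_abs_second_difference_sub_le hQ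
  have hpos : ∀ h w : E, 2 * (lam * ‖w‖ ^ 2) ≤ T (h, w) (h, w) := by
    intro h w
    have hcont : ∀ h : E, Tendsto (fun s : ℝ => Q (z + s • h, w)) (𝓝 0) (𝓝 (Q (z, w))) := by
      intro h
      have e1 : ∀ᶠ p in 𝓝 ((z, 0) : E × E), ContinuousAt Q p := by
        filter_upwards [hQ.eventually (by simp)] with p hp using hp.continuousAt
      have e2 : Tendsto (fun t : ℝ => ((z, t • w) : E × E)) (𝓝 0) (𝓝 (z, 0)) := by
        have : Continuous (fun t : ℝ => ((z, t • w) : E × E)) := by fun_prop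
        simpa using this.tendsto 0
      obtain ⟨t, ht, ht0⟩ := (((e2.eventually e1).filter_mono nhdsWithin_le_nhds).and
        (self_mem_nhdsWithin (s := {0}ᶜ))).exists
      have e3 : ∀ y, Q (y, w) = (t ^ 2)⁻¹ * Q (y, t • w) := by
        intro y
        rw [hsmul]
        have : t ≠ 0 := ht0
        field_simp
      simp only [e3]
      refine Tendsto.const_mul _ (ht.tendsto.comp ?_)
      have : Continuous (fun s : ℝ => ((z + s • h, t • w) : E × E)) := by fun_prop
      simpa using this.tendsto 0
    have hle : ∀ ε > 0, 2 * (lam * ‖w‖ ^ 2) ≤ T (h, w) (h, w) + ε * ‖((h, w) : E × E)‖ ^ 2 := by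
      intro ε hε
      obtain ⟨δ, hδ, hd⟩ := hT ε hε
      have hlim := (hcont h).add (hcont (-h))
      refine le_trans ?_ (le_of_tendsto (x := 𝓝[≠] (0 : ℝ)) (hlim.mono_left nhdsWithin_le_nhds) ?_)
      · linarith [hlow w]
      have hin : ∀ k : E × E, ∀ᶠ s : ℝ in 𝓝[≠] 0, ((z, 0) : E × E) + s • k ∈ Metric.ball (z, 0) δ := by
        intro k
        have : Continuous (fun s : ℝ => ((z, 0) : E × E) + s • k) := by fun_prop
        have := (this.tendsto 0).eventually (Metric.isOpen_ball.mem_nhds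
          (show (z, 0) + (0 : ℝ) • k ∈ Metric.ball ((z, 0) : E × E) δ by
            rw [zero_smul, add_zero]; exact Metric.mem_ball_self hδ))
        exact this.filter_mono nhdsWithin_le_nhds
      filter_upwards [hin (h, w), hin (-(h, w)), self_mem_nhdsWithin] with s h1 h2 hs
      have h3 := hd (z, 0) (s • (h, w)) h1 (by simpa [sub_eq_add_neg] using h2)
      have h4 : Q (z, 0) = 0 := by simpa using hsmul z 0 0
      have h5 : Q ((z, 0) + s • (h, w)) = s ^ 2 * Q (z + s • h, w) := by
        rw [← hsmul]; simp
      have h6 : Q ((z, 0) - s • (h, w)) = s ^ 2 * Q (z + s • -h, w) := by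
        have := hsmul (z + s • -h) (-s) w
        rw [neg_sq] at this
        rw [← this]; simp [sub_eq_add_neg]
      rw [h4, h5, h6] at h3
      simp only [map_smul, smul_apply, norm_smul, smul_eq_mul, mul_pow,
        Real.norm_eq_abs, sq_abs] at h3
      have h7 := (abs_le.1 h3).2
      have h8 : 0 < s ^ 2 := by have : s ≠ 0 := hs; positivity
      refine le_of_mul_le_mul_left ?_ h8
      linarith
    refine le_of_forall_pos_le_add fun η hη => ?_
    refine (hle (η / (‖((h, w) : E × E)‖ ^ 2 + 1)) (by positivity)).trans ?_
    gcongr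
    rw [div_mul_eq_mul_div, div_le_iff₀ (by positivity)]
    gcongr
    linarith
  obtain ⟨δ, hδ, hd⟩ := hT (lam / 2) (by positivity)
  refine ⟨δ, hδ, fun x h v w h1 h2 h3 h4 => ?_⟩
  have h5 := (abs_le.1 (hd (x, v) (h, w)
    (by simp [dist_eq_norm, h1, h3]) (by simp [dist_eq_norm, h2, h4]))).1
  have h6 := hpos h w
  have h7 : ‖((h, w) : E × E)‖ ^ 2 ≤ ‖h‖ ^ 2 + ‖w‖ ^ 2 := by
    rw [Prod.norm_def]
    rcases max_cases ‖h‖ ‖w‖ with hm | hm <;> rw [hm.1] <;> nlinarith [sq_nonneg ‖h‖, sq_nonneg ‖w‖]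
  simp only [Prod.mk_add_mk, Prod.mk_sub_mk] at h5
  nlinarith [mul_le_mul_of_nonneg_left h7 (by positivity : 0 ≤ lam / 2), sq_nonneg ‖w‖]

/-- A discrete Poincaré inequality. -/
lemma natCast_mul_norm_sq_le_sum {h : ℕ → E} (h0 : h 0 = 0) {N k : ℕ} (hk : k ≤ N) :
    (N : ℝ) * ‖h k‖ ^ 2 ≤ ∑ i ∈ Finset.range N, ‖(N : ℝ) • (h (i + 1) - h i)‖ ^ 2 := by
  have h1 : ‖h k‖ ≤ ∑ i ∈ Finset.range N, ‖h (i + 1) - h i‖ := by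
    have : h k = ∑ i ∈ Finset.range k, (h (i + 1) - h i) := by
      rw [Finset.sum_range_sub, h0, sub_zero]
    rw [this]
    refine (norm_sum_le _ _).trans (Finset.sum_le_sum_of_subset_of_nonneg
      (Finset.range_mono hk) fun _ _ _ => norm_nonneg _)
  have h2 : (∑ i ∈ Finset.range N, ‖h (i + 1) - h i‖) ^ 2 ≤
      N * ∑ i ∈ Finset.range N, ‖h (i + 1) - h i‖ ^ 2 := by
    simpa using sq_sum_le_card_mul_sum_sq (s := Finset.range N) (f := fun i => ‖h (i + 1) - h i‖)
  have h3 := pow_le_pow_left₀ (norm_nonneg _) h1 2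
  simp only [norm_smul, mul_pow, Real.norm_eq_abs, sq_abs, ← Finset.mul_sum]
  calc (N : ℝ) * ‖h k‖ ^ 2 ≤ N * (N * ∑ i ∈ Finset.range N, ‖h (i + 1) - h i‖ ^ 2) := by
        gcongr; exact h3.trans h2
    _ = _ := by ring

end QuadraticModel

/-- `c` restricted to `[0, 1]` is a constant speed minimizing geodesic from `p` to `q`. -/
structure IsMinGeodesic {X : Type*} [PseudoMetricSpace X] (p q : X) (c : ℝ → X) : Prop where
  map_zero : c 0 = p
  map_one : c 1 = q
  dist_le : ∀ s ∈ Icc (0 : ℝ) 1, ∀ t ∈ Icc (0 : ℝ) 1, dist (c s) (c t) ≤ dist p q * |s - t|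

namespace IsLocalMetricModel

variable {E M : Type*} [NormedAddCommGroup E] [NormedSpace ℝ E] [MetricSpace M]
  {x₀ : M} {φ : M → E} {ψ : E → M} {Q : E × E → ℝ} {r C lam : ℝ}

/-- The comparison of two minimizing geodesics sampled at the multiples of `1 / N`. -/
lemma norm_sub_sq_le (hm : IsLocalMetricModel x₀ φ ψ Q r C lam) {δ ε B D : ℝ}
    (hconv : ∀ x h v w : E, ‖x + h - φ x₀‖ < δ → ‖x - h - φ x₀‖ < δ → ‖v + w‖ < δ →
      ‖v - w‖ < δ → lam * ‖w‖ ^ 2 - lam / 2 * ‖h‖ ^ 2 ≤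
        Q (x + h, v + w) + Q (x - h, v - w) - 2 * Q (x, v))
    {ρ : ℝ} (hε : 0 ≤ ε) (habs : ∀ a ∈ Metric.ball (φ x₀) r, ∀ b ∈ Metric.ball (φ x₀) r,
      ‖b - a‖ < ρ → |dist (ψ a) (ψ b) ^ 2 - Q (a, b - a)| ≤ ε * ‖b - a‖ ^ 2)
    {N : ℕ} (hN : 0 < N) (hBδ : B < δ) (hBρ : B < ρ * N) {x y : ℕ → M}
    (hx : ∀ i ≤ N, x i ∈ Metric.ball x₀ r) (hy : ∀ i ≤ N, y i ∈ Metric.ball x₀ r)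
    (hφx : ∀ i ≤ N, φ (x i) ∈ Metric.ball (φ x₀) (min r δ))
    (hφy : ∀ i ≤ N, φ (y i) ∈ Metric.ball (φ x₀) (min r δ))
    (hDx : ∀ i < N, N * dist (x i) (x (i + 1)) ≤ D) (hDy : ∀ i < N, N * dist (y i) (y (i + 1)) ≤ D)
    (hBx : ∀ i < N, N * ‖φ (x (i + 1)) - φ (x i)‖ ≤ B)
    (hBy : ∀ i < N, N * ‖φ (y (i + 1)) - φ (y i)‖ ≤ B)
    (h0 : x 0 = y 0) (h1 : x N = y N) (hD : D = dist (x 0) (x N)) {k : ℕ} (hk : k ≤ N) :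
    lam * ‖(2⁻¹ : ℝ) • (φ (x k) - φ (y k))‖ ^ 2 ≤ 8 * ε * B ^ 2 := by
  have hN' : (0 : ℝ) < N := by exact_mod_cast hN
  let X : ℕ → E := fun i => φ (x i)
  let Y : ℕ → E := fun i => φ (y i)
  let m : ℕ → E := fun i => (2⁻¹ : ℝ) • (X i + Y i)
  let h : ℕ → E := fun i => (2⁻¹ : ℝ) • (X i - Y i)
  have hmb : ∀ i ≤ N, m i ∈ Metric.ball (φ x₀) (min r δ) := by
    intro i hi
    have := (convex_ball (φ x₀) (min r δ)) (hφx i hi) (hφy i hi) (a := 2⁻¹) (b := 2⁻¹)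
      (by norm_num) (by norm_num) (by norm_num)
    simpa [m, X, Y, smul_add] using this
  have hscale : ∀ (Z : ℕ → E) i, Q (Z i, (N : ℝ) • (Z (i + 1) - Z i)) =
      N ^ 2 * Q (Z i, Z (i + 1) - Z i) := fun Z i => hm.map_smul _ _ _
  have hside : ∀ (x : ℕ → M) (hx : ∀ i ≤ N, x i ∈ Metric.ball x₀ r)
      (hφx : ∀ i ≤ N, φ (x i) ∈ Metric.ball (φ x₀) (min r δ))
      (hDx : ∀ i < N, N * dist (x i) (x (i + 1)) ≤ D)
      (hBx : ∀ i < N, N * ‖φ (x (i + 1)) - φ (x i)‖ ≤ B), ∀ i < N,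
      Q (φ (x i), (N : ℝ) • (φ (x (i + 1)) - φ (x i))) ≤ D ^ 2 + ε * B ^ 2 := by
    intro x hx hφx hDx hBx i hi
    have e1 := habs _ (Metric.ball_subset_ball (min_le_left _ _) (hφx i hi.le)) _
      (Metric.ball_subset_ball (min_le_left _ _) (hφx (i + 1) hi)) (by
        have := (hBx i hi).trans_lt hBρ
        rw [mul_comm] at this
        exact lt_of_mul_lt_mul_right this hN'.le)
    rw [hm.left_inv _ (hx i hi.le), hm.left_inv _ (hx (i + 1) hi)] at e1
    have e2 := (abs_le.1 e1).1
    have e3 := pow_le_pow_left₀ (by positivity) (hDx i hi) 2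
    have e4 := pow_le_pow_left₀ (by positivity) (hBx i hi) 2
    rw [hm.map_smul]
    calc (N : ℝ) ^ 2 * Q (φ (x i), φ (x (i + 1)) - φ (x i))
        ≤ N ^ 2 * (dist (x i) (x (i + 1)) ^ 2 + ε * ‖φ (x (i + 1)) - φ (x i)‖ ^ 2) := by
          gcongr; linarith
      _ = (N * dist (x i) (x (i + 1))) ^ 2 + ε * (N * ‖φ (x (i + 1)) - φ (x i)‖) ^ 2 := by ring
      _ ≤ _ := by gcongr
  have hmB : ∀ i < N, N * ‖m (i + 1) - m i‖ ≤ B := by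
    intro i hi
    have e1 : m (i + 1) - m i = (2⁻¹ : ℝ) • ((X (i + 1) - X i) + (Y (i + 1) - Y i)) := by
      simp only [m]; module
    rw [e1, norm_smul]
    have := norm_add_le (X (i + 1) - X i) (Y (i + 1) - Y i)
    have h2 := hBx i hi
    have h3 := hBy i hi
    have h4 := mul_le_mul_of_nonneg_left this hN'.le
    norm_num
    simp only [X, Y] at *
    linarith
  have hmid : ∀ i < N, N ^ 2 * dist (ψ (m i)) (ψ (m (i + 1))) ^ 2 - ε * B ^ 2 ≤
      Q (m i, (N : ℝ) • (m (i + 1) - m i)) := by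
    intro i hi
    have e1 := habs _ (Metric.ball_subset_ball (min_le_left _ _) (hmb i hi.le)) _
      (Metric.ball_subset_ball (min_le_left _ _) (hmb (i + 1) hi)) (by
        have := (hmB i hi).trans_lt hBρ
        rw [mul_comm] at this
        exact lt_of_mul_lt_mul_right this hN'.le)
    have e2 := (abs_le.1 e1).2
    have e4 := pow_le_pow_left₀ (by positivity) (hmB i hi) 2
    rw [hm.map_smul]
    have e5 := mul_le_mul_of_nonneg_left e2 (sq_nonneg (N : ℝ))
    have e6 := mul_le_mul_of_nonneg_left e4 hε
    rw [mul_pow] at e6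
    linarith
  have hsum : (N : ℝ) * D ^ 2 ≤
      ∑ i ∈ Finset.range N, N ^ 2 * dist (ψ (m i)) (ψ (m (i + 1))) ^ 2 := by
    have e1 : D ≤ ∑ i ∈ Finset.range N, dist (ψ (m i)) (ψ (m (i + 1))) := by
      have := dist_le_range_sum_dist (fun i => ψ (m i)) N
      have hm0 : ψ (m 0) = x 0 := by
        have : m 0 = φ (x 0) := by simp only [m, X, Y, ← h0]; module
        rw [this, hm.left_inv _ (hx 0 (Nat.zero_le _))]
      have hmN : ψ (m N) = x N := by
        have : m N = φ (x N) := by simp only [m, X, Y, ← h1]; module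
        rw [this, hm.left_inv _ (hx N le_rfl)]
      simpa only [hm0, hmN, ← hD] using this
    have e2 := sq_sum_le_card_mul_sum_sq (s := Finset.range N)
      (f := fun i => dist (ψ (m i)) (ψ (m (i + 1))))
    rw [Finset.card_range] at e2
    have e3 := pow_le_pow_left₀ (hD ▸ dist_nonneg) e1 2
    rw [← Finset.mul_sum]
    calc (N : ℝ) * D ^ 2 ≤ N * (N * ∑ i ∈ Finset.range N, dist (ψ (m i)) (ψ (m (i + 1))) ^ 2) := by
          gcongr; exact e3.trans e2
      _ = _ := by ring
  have hB0 : 0 ≤ B := le_trans (by positivity) (hBx 0 hN)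
  have hterm : ∀ i < N, lam * ‖(N : ℝ) • (h (i + 1) - h i)‖ ^ 2 - lam / 2 * ‖h i‖ ^ 2 ≤
      2 * D ^ 2 + 4 * ε * B ^ 2 - 2 * (N ^ 2 * dist (ψ (m i)) (ψ (m (i + 1))) ^ 2) := by
    intro i hi
    have a1 : m i + h i = X i := by simp only [m, h]; module
    have a2 : m i - h i = Y i := by simp only [m, h]; module
    have a3 : (N : ℝ) • (m (i + 1) - m i) + (N : ℝ) • (h (i + 1) - h i) =
      (N : ℝ) • (X (i + 1) - X i) := by simp only [m, h]; module
    have a4 : (N : ℝ) • (m (i + 1) - m i) - (N : ℝ) • (h (i + 1) - h i) =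
      (N : ℝ) • (Y (i + 1) - Y i) := by simp only [m, h]; module
    have b1 := hconv (m i) (h i) ((N : ℝ) • (m (i + 1) - m i)) ((N : ℝ) • (h (i + 1) - h i))
    rw [a1, a2, a3, a4] at b1
    have b2 := b1 ((mem_ball_iff_norm.1 (hφx i hi.le)).trans_le (min_le_right _ _))
      ((mem_ball_iff_norm.1 (hφy i hi.le)).trans_le (min_le_right _ _))
      (by rw [norm_smul, Real.norm_natCast]; exact (hBx i hi).trans_lt hBδ)
      (by rw [norm_smul, Real.norm_natCast]; exact (hBy i hi).trans_lt hBδ)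
    have c1 := hside x hx hφx hDx hBx i hi
    have c2 := hside y hy hφy hDy hBy i hi
    have c3 := hmid i hi
    simp only [X, Y] at b2
    linarith
  have htot := Finset.sum_le_sum fun i (hi : i ∈ Finset.range N) => hterm i (Finset.mem_range.1 hi)
  rw [Finset.sum_sub_distrib, Finset.sum_sub_distrib, ← Finset.mul_sum, ← Finset.mul_sum,
    ← Finset.mul_sum, Finset.sum_const, Finset.card_range, nsmul_eq_mul] at htot
  have hh0 : h 0 = 0 := by simp [h, X, Y, h0]
  set W := ∑ i ∈ Finset.range N, ‖(N : ℝ) • (h (i + 1) - h i)‖ ^ 2 with hW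
  have hsumh : ∑ i ∈ Finset.range N, ‖h i‖ ^ 2 ≤ W := by
    have : ∀ i ∈ Finset.range N, ‖h i‖ ^ 2 ≤ W / N := fun i hi => by
      rw [le_div_iff₀ hN', mul_comm]
      exact natCast_mul_norm_sq_le_sum hh0 (Finset.mem_range.1 hi).le
    refine (Finset.sum_le_sum this).trans (le_of_eq ?_)
    rw [Finset.sum_const, Finset.card_range, nsmul_eq_mul]
    field_simp
  have hpk := natCast_mul_norm_sq_le_sum hh0 hk
  have hlam := hm.lam_pos
  have f1 := mul_le_mul_of_nonneg_left hsumh (by positivity : 0 ≤ lam / 2)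
  have f2 := mul_le_mul_of_nonneg_left hpk (by positivity : 0 ≤ lam / 2)
  have f3 : (N : ℝ) * (lam * ‖h k‖ ^ 2) ≤ N * (8 * ε * B ^ 2) := by linarith
  exact le_of_mul_le_mul_left f3 hN'

theorem exists_eqOn_of_isMinGeodesic (hm : IsLocalMetricModel x₀ φ ψ Q r C lam) :
    ∃ ρ > 0, ∀ p ∈ Metric.ball x₀ ρ, ∀ q ∈ Metric.ball x₀ ρ, ∀ c c' : ℝ → M,
      IsMinGeodesic p q c → IsMinGeodesic p q c' → EqOn c c' (Icc 0 1) := by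
  obtain ⟨δ, hδ, hconv⟩ :=
    exists_mul_sq_sub_le_second_difference hm.lam_pos hm.contDiffAt hm.map_smul hm.le_apply
  have hr := hm.r_pos
  have hC := hm.C_pos
  have hlam := hm.lam_pos
  set ρ₀ := min (r / 3) (min r δ / (3 * C)) with hρ₀
  have hρ0 : 0 < ρ₀ := by positivity
  have hρr : 3 * ρ₀ ≤ r := by have := min_le_left (r / 3) (min r δ / (3 * C)); linarith
  have hρC : 3 * (C * ρ₀) ≤ min r δ := by
    have := min_le_right (r / 3) (min r δ / (3 * C))
    rw [← hρ₀, le_div_iff₀ (by positivity)] at this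
    linarith
  refine ⟨ρ₀, hρ0, fun p hp q hq c c' hc hc' t ht => ?_⟩
  have hpq : dist p q < 2 * ρ₀ := by
    have := dist_triangle_right p q x₀
    rw [Metric.mem_ball] at hp hq
    linarith
  set D := dist p q with hD
  have hball : ∀ c, IsMinGeodesic p q c → ∀ s ∈ Icc (0 : ℝ) 1, c s ∈ Metric.ball x₀ r ∧
      φ (c s) ∈ Metric.ball (φ x₀) (min r δ) := by
    intro c hc s hs
    have h1 := hc.dist_le s hs 0 ⟨le_rfl, zero_le_one⟩
    rw [hc.map_zero, sub_zero, abs_of_nonneg hs.1] at h1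
    have h2 : D * s ≤ D * 1 := by gcongr; exact hs.2
    have h3 := dist_triangle (c s) p x₀
    rw [Metric.mem_ball] at hp
    have h4 : dist (c s) x₀ < 3 * ρ₀ := by linarith
    have h5 : c s ∈ Metric.ball x₀ r := Metric.mem_ball.2 (h4.trans_le hρr)
    refine ⟨h5, ?_⟩
    rw [mem_ball_iff_norm]
    refine (hm.norm_sub_le _ h5 _ (Metric.mem_ball_self hr)).trans_lt (lt_of_lt_of_le ?_ hρC)
    have := mul_lt_mul_of_pos_left h4 hC
    linarith
  have hφLip : ∀ c, IsMinGeodesic p q c → ∀ s ∈ Icc (0 : ℝ) 1, ∀ s' ∈ Icc (0 : ℝ) 1,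
      ‖φ (c s) - φ (c s')‖ ≤ C * D * |s - s'| := by
    intro c hc s hs s' hs'
    refine (hm.norm_sub_le _ (hball c hc s hs).1 _ (hball c hc s' hs').1).trans ?_
    rw [mul_assoc]
    gcongr
    exact hc.dist_le s hs s' hs'
  have hB : C * D < δ := by
    have h1 := mul_lt_mul_of_pos_left hpq hC
    have h2 := min_le_right r δ
    have h3 : 0 < C * ρ₀ := by positivity
    linarith
  set h := ‖(2⁻¹ : ℝ) • (φ (c t) - φ (c' t))‖ with hh
  have main : ∀ ε > 0, h ≤ √(8 * ε * (C * D) ^ 2 / lam) := by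
    intro ε hε
    obtain ⟨ρ, hρ, habs⟩ := hm.abs_sub_le ε hε
    have hlim : Tendsto (fun N : ℕ => C * D / (N : ℝ) + √(8 * ε * (C * D) ^ 2 / lam)) atTop
        (𝓝 (0 + √(8 * ε * (C * D) ^ 2 / lam))) :=
      (tendsto_const_div_atTop_nhds_zero_nat _).add_const _
    rw [zero_add] at hlim
    refine ge_of_tendsto hlim ?_
    obtain ⟨N₀, hN₀⟩ := exists_nat_gt (C * D / ρ)
    filter_upwards [eventually_ge_atTop (max N₀ 1)] with N hN
    have hN1 : 0 < N := lt_of_lt_of_le one_pos ((le_max_right _ _).trans hN)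
    have hN' : (0 : ℝ) < N := by exact_mod_cast hN1
    have hNρ : C * D < ρ * N := by
      rw [div_lt_iff₀ hρ] at hN₀
      have : (N₀ : ℝ) ≤ N := by exact_mod_cast (le_max_left _ _).trans hN
      nlinarith
    have hI : ∀ i ≤ N, (i : ℝ) / N ∈ Icc (0 : ℝ) 1 := fun i hi =>
      ⟨by positivity, by rw [div_le_one hN']; exact_mod_cast hi⟩
    have hstep : ∀ i : ℕ, |((i + 1 : ℕ) : ℝ) / N - (i : ℝ) / N| = 1 / N := fun i => by
      rw [← sub_div, Nat.cast_succ, add_sub_cancel_left, abs_of_nonneg (by positivity)]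
    have hstep' : ∀ i : ℕ, |(i : ℝ) / N - ((i + 1 : ℕ) : ℝ) / N| = 1 / N := fun i => by
      rw [abs_sub_comm, hstep]
    have hdist : ∀ c, IsMinGeodesic p q c → ∀ i < N,
        N * dist (c ((i : ℝ) / N)) (c (((i + 1 : ℕ) : ℝ) / N)) ≤ D := by
      intro c hc i hi
      have := hc.dist_le _ (hI i hi.le) _ (hI (i + 1) hi)
      rw [hstep', mul_one_div, le_div_iff₀ hN'] at this
      linarith
    have hnorm : ∀ c, IsMinGeodesic p q c → ∀ i < N,
        N * ‖φ (c (((i + 1 : ℕ) : ℝ) / N)) - φ (c ((i : ℝ) / N))‖ ≤ C * D := by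
      intro c hc i hi
      have := hφLip c hc _ (hI (i + 1) hi) _ (hI i hi.le)
      rw [hstep, mul_one_div, le_div_iff₀ hN'] at this
      linarith
    have h0 : ∀ c, IsMinGeodesic p q c → c (((0 : ℕ) : ℝ) / N) = p := fun c hc => by
      simp [hc.map_zero]
    have h1 : ∀ c, IsMinGeodesic p q c → c ((N : ℝ) / N) = q := fun c hc => by
      rw [div_self hN'.ne', hc.map_one]
    set k := ⌊t * N⌋₊ with hk
    have hkN : k ≤ N := Nat.floor_le_of_le (by nlinarith [ht.2])
    have key := hm.norm_sub_sq_le hconv hε.le habs hN1 hB hNρ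
      (x := fun i => c ((i : ℝ) / N)) (y := fun i => c' ((i : ℝ) / N)) (D := D)
      (fun i hi => (hball c hc _ (hI i hi)).1) (fun i hi => (hball c' hc' _ (hI i hi)).1)
      (fun i hi => (hball c hc _ (hI i hi)).2) (fun i hi => (hball c' hc' _ (hI i hi)).2)
      (hdist c hc) (hdist c' hc') (hnorm c hc) (hnorm c' hc') (by rw [h0 c hc, h0 c' hc'])
      (by rw [h1 c hc, h1 c' hc']) (by rw [h0 c hc, h1 c hc]) hkN
    have key2 : ‖(2⁻¹ : ℝ) • (φ (c ((k : ℝ) / N)) - φ (c' ((k : ℝ) / N)))‖ ≤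
        √(8 * ε * (C * D) ^ 2 / lam) := by
      refine Real.le_sqrt_of_sq_le ?_
      rw [le_div_iff₀ hlam]
      linarith
    have htk : |t - (k : ℝ) / N| ≤ 1 / N := by
      have e1 := Nat.floor_le (by have := ht.1; positivity : 0 ≤ t * N)
      have e2 := Nat.lt_floor_add_one (t * N)
      rw [abs_of_nonneg (by rw [sub_nonneg, div_le_iff₀ hN']; exact e1), sub_le_iff_le_add,
        ← add_div, le_div_iff₀ hN']
      linarith
    have l1 := hφLip c hc t ht _ (hI k hkN)
    have l2 := hφLip c' hc' t ht _ (hI k hkN)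
    have l3 : C * D * |t - (k : ℝ) / N| ≤ C * D / N := by
      rw [← mul_one_div (C * D)]; exact mul_le_mul_of_nonneg_left htk (by positivity)
    have dec : (2⁻¹ : ℝ) • (φ (c t) - φ (c' t)) =
        (2⁻¹ : ℝ) • (φ (c ((k : ℝ) / N)) - φ (c' ((k : ℝ) / N))) +
        ((2⁻¹ : ℝ) • (φ (c t) - φ (c ((k : ℝ) / N))) -
          (2⁻¹ : ℝ) • (φ (c' t) - φ (c' ((k : ℝ) / N)))) := by module
    rw [hh, dec]
    refine (norm_add_le _ _).trans ?_
    have n1 := _root_.norm_sub_le ((2⁻¹ : ℝ) • (φ (c t) - φ (c ((k : ℝ) / N))))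
          ((2⁻¹ : ℝ) • (φ (c' t) - φ (c' ((k : ℝ) / N))))
    rw [norm_smul, norm_smul] at n1
    norm_num at n1
    linarith
  have hle : h ≤ 0 := by
    have hlim : Tendsto (fun ε => √(8 * ε * (C * D) ^ 2 / lam)) (𝓝[>] 0) (𝓝 0) := by
      have : Continuous (fun ε => √(8 * ε * (C * D) ^ 2 / lam)) := by fun_prop
      simpa using (this.tendsto 0).mono_left nhdsWithin_le_nhds
    refine ge_of_tendsto hlim ?_
    filter_upwards [self_mem_nhdsWithin] with ε hε using main ε hε
  have h0 : (2⁻¹ : ℝ) • (φ (c t) - φ (c' t)) = 0 := norm_le_zero_iff.1 hle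
  have h1 : φ (c t) = φ (c' t) := by
    rw [smul_eq_zero] at h0
    exact sub_eq_zero.1 (h0.resolve_left (by norm_num))
  rw [← hm.left_inv _ (hball c hc t ht).1, h1, hm.left_inv _ (hball c' hc' t ht).1]

end IsLocalMetricModel

section LengthSpace

variable {X : Type*} [MetricSpace X]

/-- A complete locally compact length space is proper. -/
theorem properSpace_of_exists_dist_lt [CompleteSpace X] [LocallyCompactSpace X]
    (hlen : ∀ (p q : X) (a b : ℝ), 0 < a → 0 < b → dist p q < a + b →
      ∃ m, dist p m < a ∧ dist m q < b) : ProperSpace X := by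
  refine ⟨fun x => ?_⟩
  by_contra! hcon
  obtain ⟨R₀, hR₀⟩ := hcon
  set S := {R : ℝ | IsCompact (Metric.closedBall x R)} with hS
  have hdown : ∀ R ∈ S, ∀ R' ≤ R, R' ∈ S := fun R hR R' h =>
    hR.of_isClosed_subset Metric.isClosed_closedBall (Metric.closedBall_subset_closedBall h)
  have hbdd : BddAbove S := ⟨R₀, fun R hR => le_of_lt (by
    by_contra! h; exact hR₀ (hdown R hR _ h))⟩
  obtain ⟨r, hr, hrS⟩ : ∃ r > 0, r ∈ S := by
    obtain ⟨K, hK, hxK⟩ := exists_compact_mem_nhds x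
    obtain ⟨r, hr, h⟩ := Metric.nhds_basis_closedBall.mem_iff.1 hxK
    exact ⟨r, hr, hK.of_isClosed_subset Metric.isClosed_closedBall h⟩
  set s := sSup S with hs
  have hs0 : 0 < s := hr.trans_le (le_csSup hbdd hrS)
  have hlt : ∀ R < s, R ∈ S := fun R hR => by
    obtain ⟨R', hR', h⟩ := exists_lt_of_lt_csSup ⟨r, hrS⟩ hR
    exact hdown R' hR' R h.le
  have hsS : IsCompact (Metric.closedBall x s) := by
    refine TotallyBounded.isCompact_of_isClosed ?_ Metric.isClosed_closedBall
    rw [Metric.totallyBounded_iff]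
    intro ε hε
    set η := min ε s / 2 with hη
    have hη0 : 0 < η := by positivity
    have hηε : 2 * η ≤ ε := by linarith [min_le_left ε s]
    have hηs : 2 * η ≤ s := by linarith [min_le_right ε s]
    obtain ⟨t, ht, hcov⟩ := Metric.totallyBounded_iff.1 (hlt (s - η / 2) (by linarith)).totallyBounded
      η hη0
    refine ⟨t, ht, fun y hy => ?_⟩
    rw [Metric.mem_closedBall'] at hy
    obtain ⟨m, hm1, hm2⟩ := hlen x y (s - η / 2) η (by linarith) hη0 (by linarith)
    obtain ⟨z, hz, hmz⟩ := mem_iUnion₂.1 (hcov (Metric.mem_closedBall'.2 hm1.le))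
    refine mem_iUnion₂.2 ⟨z, hz, ?_⟩
    rw [Metric.mem_ball] at hmz ⊢
    linarith [dist_triangle_left y z m]
  obtain ⟨δ, hδ, hc⟩ := hsS.exists_isCompact_cthickening
  have : s + δ / 2 ∈ S := by
    refine hc.of_isClosed_subset Metric.isClosed_closedBall fun y hy => ?_
    rw [Metric.mem_closedBall'] at hy
    obtain ⟨m, hm1, hm2⟩ := hlen x y s δ hs0 hδ (by linarith)
    exact Metric.mem_cthickening_of_dist_le y m δ _ (Metric.mem_closedBall'.2 hm1.le)
      (by rw [dist_comm]; exact hm2.le)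
  linarith [le_csSup hbdd this]

lemma exists_chain (hlen : ∀ (p q : X) (a b : ℝ), 0 < a → 0 < b → dist p q < a + b →
      ∃ m, dist p m < a ∧ dist m q < b) {η : ℝ} (hη : 0 < η) (N : ℕ) (p q : X)
    (h : dist p q < (N + 1) * η) :
    ∃ m : ℕ → X, m 0 = p ∧ m (N + 1) = q ∧ ∀ i ≤ N, dist (m i) (m (i + 1)) ≤ η := by
  induction N generalizing p with
  | zero =>
    refine ⟨fun i => if i = 0 then p else q, by simp, by simp, fun i hi => ?_⟩
    obtain rfl : i = 0 := by omega
    simpa using h.le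
  | succ N ih =>
    obtain ⟨y, hy1, hy2⟩ := hlen p q η ((N + 1) * η) hη (by positivity)
      (by push_cast at h; linarith)
    obtain ⟨m, h0, h1, h2⟩ := ih y hy2
    refine ⟨fun i => if i = 0 then p else m (i - 1), by simp, by simpa using h1, fun i hi => ?_⟩
    rcases i with _ | i
    · simpa [h0] using hy1.le
    · simpa using h2 i (by omega)

/-- In a proper length space any two points are joined by a minimizing geodesic. -/
theorem exists_isMinGeodesic [ProperSpace X]
    (hlen : ∀ (p q : X) (a b : ℝ), 0 < a → 0 < b → dist p q < a + b →
      ∃ m, dist p m < a ∧ dist m q < b) (p q : X) : ∃ c : ℝ → X, IsMinGeodesic p q c := by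
  set D := dist p q with hD
  have hD0 : 0 ≤ D := dist_nonneg
  let η : ℕ → ℝ := fun N => (D + 1 / ((N : ℝ) + 1)) / ((N : ℝ) + 1)
  have hN1 : ∀ N : ℕ, (0 : ℝ) < (N : ℝ) + 1 := fun N => by positivity
  have hη : ∀ N, 0 < η N := fun N => by have := hN1 N; positivity
  have hηD : ∀ N : ℕ, ((N : ℝ) + 1) * η N = D + 1 / ((N : ℝ) + 1) := fun N =>
    mul_div_cancel₀ _ (hN1 N).ne'
  choose m hm0 hm1 hm using fun N : ℕ => exists_chain hlen (hη N) N p q (by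
    rw [hηD]; have := hN1 N; have : 0 < 1 / ((N : ℝ) + 1) := by positivity
    linarith)
  let c : ℕ → ℝ → X := fun N t => m N ⌊t * (N + 1)⌋₊
  let e : ℕ → ℝ → ℝ := fun N a => a * (D + 1 / ((N : ℝ) + 1)) + η N
  have hcle : ∀ N s t, 0 ≤ s → s ≤ t → t ≤ 1 → dist (c N s) (c N t) ≤ e N (t - s) := by
    intro N s t hs hst ht
    have h1 : ⌊s * ((N : ℝ) + 1)⌋₊ ≤ ⌊t * ((N : ℝ) + 1)⌋₊ := by
      have := hN1 N
      gcongr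
    have h2 : ⌊t * ((N : ℝ) + 1)⌋₊ ≤ N + 1 :=
      Nat.floor_le_of_le (by push_cast; nlinarith [hN1 N])
    have h3 := dist_le_Ico_sum_of_dist_le (f := m N) h1 (d := fun _ => η N)
      (fun {k} hk1 hk2 => hm N k (by omega))
    refine h3.trans ?_
    rw [Finset.sum_const, Nat.card_Ico, nsmul_eq_mul, Nat.cast_sub h1]
    have h4 := Nat.floor_le (mul_nonneg (hs.trans hst) (hN1 N).le)
    have h5 := Nat.lt_floor_add_one (s * ((N : ℝ) + 1))
    calc _ ≤ ((t - s) * ((N : ℝ) + 1) + 1) * η N := by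
          have := (hη N).le
          gcongr
          linarith
      _ = _ := by simp only [e]; rw [← hηD]; ring
  have hcle' : ∀ N, ∀ s ∈ Icc (0 : ℝ) 1, ∀ t ∈ Icc (0 : ℝ) 1,
      dist (c N s) (c N t) ≤ e N |s - t| := by
    intro N s hs t ht
    rcases le_total s t with h | h
    · rw [abs_sub_comm, abs_of_nonneg (sub_nonneg.2 h)]
      exact hcle N s t hs.1 h ht.2
    · rw [abs_of_nonneg (sub_nonneg.2 h), dist_comm]
      exact hcle N t s ht.1 h hs.2
  have hlim : ∀ a, Tendsto (fun N => e N a) atTop (𝓝 (a * D)) := by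
    intro a
    have h1 := tendsto_one_div_add_atTop_nhds_zero_nat (𝕜 := ℝ)
    have h2 := (h1.const_add D).const_mul a
    have h3 := (h1.const_add D).mul h1
    have h4 := h2.add h3
    simp only [add_zero, mul_zero] at h4
    refine h4.congr fun N => ?_
    simp only [e, η]
    rw [mul_one_div]
  have hc0 : ∀ N, c N 0 = p := fun N => by simp [c, hm0]
  have hc1 : ∀ N, c N 1 = q := fun N => by
    have : ⌊(N : ℝ) + 1⌋₊ = N + 1 := by exact_mod_cast Nat.floor_natCast (R := ℝ) (N + 1)
    simp [c, this, hm1]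
  have hex : ∀ t ∈ Icc (0 : ℝ) 1, ∃ y, Tendsto (fun N => c N t) (hyperfilter ℕ) (𝓝 y) := by
    intro t ht
    obtain ⟨B, hB⟩ := (hlim |t - 0|).bddAbove_range
    have hmem : ∀ N, c N t ∈ Metric.closedBall p B := fun N => by
      rw [Metric.mem_closedBall, ← hc0 N]
      exact (hcle' N t ht 0 ⟨le_rfl, zero_le_one⟩).trans (hB ⟨N, rfl⟩)
    obtain ⟨y, -, hy⟩ := (isCompact_closedBall p B).ultrafilter_le_nhds
      ((hyperfilter ℕ).map (fun N => c N t))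
      (le_principal_iff.2 (Filter.mem_map.2 (Filter.mem_of_superset univ_mem
        fun N _ => hmem N)))
    exact ⟨y, hy⟩
  have : Nonempty X := ⟨p⟩
  choose! y hy using hex
  have hle : ((hyperfilter ℕ : Ultrafilter ℕ) : Filter ℕ) ≤ atTop := by
    rw [← Nat.cofinite_eq_atTop]; exact hyperfilter_le_cofinite
  refine ⟨y, ?_, ?_, fun s hs t ht => ?_⟩
  · exact tendsto_nhds_unique (hy 0 ⟨le_rfl, zero_le_one⟩)
      (tendsto_const_nhds.congr fun N => (hc0 N).symm)
  · exact tendsto_nhds_unique (hy 1 ⟨zero_le_one, le_rfl⟩)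
      (tendsto_const_nhds.congr fun N => (hc1 N).symm)
  · rw [mul_comm]
    exact le_of_tendsto_of_tendsto' ((hy s hs).dist (hy t ht)) ((hlim _).mono_left hle)
      fun N => hcle' N s hs t ht

end LengthSpace

section MinGeodesic

variable {X : Type*} [MetricSpace X]

/-- Lipschitz bounds on two adjacent intervals glue. -/
lemma dist_le_mul_abs_glue {f : ℝ → X} {K a b c : ℝ}
    (h1 : ∀ s ∈ Icc a b, ∀ t ∈ Icc a b, dist (f s) (f t) ≤ K * |s - t|)
    (h2 : ∀ s ∈ Icc b c, ∀ t ∈ Icc b c, dist (f s) (f t) ≤ K * |s - t|) :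
    ∀ s ∈ Icc a c, ∀ t ∈ Icc a c, dist (f s) (f t) ≤ K * |s - t| := by
  have key : ∀ s ∈ Icc a c, ∀ t ∈ Icc a c, s ≤ t → dist (f s) (f t) ≤ K * |s - t| := by
    intro s hs t ht hst
    rcases le_total t b with htb | htb
    · exact h1 s ⟨hs.1, hst.trans htb⟩ t ⟨ht.1, htb⟩
    rcases le_total b s with hsb | hsb
    · exact h2 s ⟨hsb, hs.2⟩ t ⟨htb, ht.2⟩
    have e1 := h1 s ⟨hs.1, hsb⟩ b ⟨hs.1.trans hsb, le_rfl⟩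
    have e2 := h2 b ⟨le_rfl, htb.trans ht.2⟩ t ⟨htb, ht.2⟩
    rw [abs_sub_comm, abs_of_nonneg (by linarith)] at e1 e2 ⊢
    have := dist_triangle (f s) (f b) (f t)
    linarith
  intro s hs t ht
  rcases le_total s t with h | h
  · exact key s hs t ht h
  · rw [dist_comm, abs_sub_comm]; exact key t ht s hs h

namespace IsMinGeodesic

variable {p q : X} {c : ℝ → X}

lemma dist_eq (hc : IsMinGeodesic p q c) {s t : ℝ} (hs : s ∈ Icc (0 : ℝ) 1)
    (ht : t ∈ Icc (0 : ℝ) 1) : dist (c s) (c t) = dist p q * |s - t| := by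
  refine le_antisymm (hc.dist_le s hs t ht) ?_
  wlog hst : s ≤ t generalizing s t
  · rw [dist_comm (c s), abs_sub_comm]; exact this ht hs (le_of_not_ge hst)
  have h1 := hc.dist_le 0 ⟨le_rfl, zero_le_one⟩ s hs
  have h2 := hc.dist_le t ht 1 ⟨zero_le_one, le_rfl⟩
  have h3 := dist_triangle4 p (c s) (c t) q
  rw [hc.map_zero, abs_sub_comm, abs_of_nonneg (by linarith [hs.1])] at h1
  rw [hc.map_one, abs_sub_comm, abs_of_nonneg (by linarith [ht.2])] at h2
  rw [abs_sub_comm, abs_of_nonneg (by linarith)]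
  linarith

end IsMinGeodesic

/-- All minimizing geodesics from `p` to `q` agree. -/
def HasUniqueMinGeodesic (p q : X) : Prop :=
  ∀ c c' : ℝ → X, IsMinGeodesic p q c → IsMinGeodesic p q c' → EqOn c c' (Icc 0 1)

/-- A minimizing geodesic from `p` to `q`, whenever one exists. -/
noncomputable def geod (p q : X) : ℝ → X :=
  @Classical.epsilon (ℝ → X) ⟨fun _ => p⟩ (IsMinGeodesic p q)

lemma isMinGeodesic_geod (hgeo : ∀ p q : X, ∃ c : ℝ → X, IsMinGeodesic p q c)
    (p q : X) : IsMinGeodesic p q (geod p q) :=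
  Classical.epsilon_spec (hgeo p q)

/-- A point dividing the distance in the ratio `t` lies on the geodesic. -/
lemma HasUniqueMinGeodesic.eq_geod (hgeo : ∀ p q : X, ∃ c : ℝ → X, IsMinGeodesic p q c)
    {p q : X} (hu : HasUniqueMinGeodesic p q) {t : ℝ}
    (ht : t ∈ Icc (0 : ℝ) 1) {m : X} (h1 : dist p m ≤ t * dist p q)
    (h2 : dist m q ≤ (1 - t) * dist p q) : m = geod p q t := by
  have hg := isMinGeodesic_geod hgeo p q
  rcases eq_or_lt_of_le ht.1 with rfl | ht0
  · rw [hg.map_zero]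
    exact (dist_le_zero.1 (by simpa using h1)).symm
  rcases eq_or_lt_of_le ht.2 with rfl | ht1
  · rw [hg.map_one]
    exact dist_le_zero.1 (by simpa using h2)
  have hg1 := isMinGeodesic_geod hgeo p m
  have hg2 := isMinGeodesic_geod hgeo m q
  let c : ℝ → X := fun s => if s ≤ t then geod p m (s / t) else geod m q ((s - t) / (1 - t))
  have ht1' : 0 < 1 - t := by linarith
  have hct : c t = m := by simp [c, div_self ht0.ne', hg1.map_one]
  have hc2 : ∀ s, t ≤ s → c s = geod m q ((s - t) / (1 - t)) := by
    intro s hs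
    rcases eq_or_lt_of_le hs with rfl | hs
    · rw [hct]; simp [hg2.map_zero]
    · simp [c, not_le.2 hs]
  have hc : IsMinGeodesic p q c := by
    refine ⟨by simp [c, ht0.le, hg1.map_zero], ?_, ?_⟩
    · rw [hc2 1 ht.2, div_self ht1'.ne', hg2.map_one]
    · refine dist_le_mul_abs_glue (b := t) (fun s hs s' hs' => ?_) (fun s hs s' hs' => ?_)
      · simp only [c, hs.2, hs'.2, if_true]
        have h3 := hg1.dist_le (s / t) ⟨by have := hs.1; positivity, (div_le_one ht0).2 hs.2⟩
          (s' / t) ⟨by have := hs'.1; positivity, (div_le_one ht0).2 hs'.2⟩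
        rw [← sub_div, abs_div, abs_of_pos ht0, ← mul_div_assoc] at h3
        refine h3.trans ((div_le_iff₀ ht0).2 ?_)
        calc _ ≤ t * dist p q * |s - s'| := by gcongr
          _ = _ := by ring
      · rw [hc2 s hs.1, hc2 s' hs'.1]
        have h3 := hg2.dist_le ((s - t) / (1 - t)) ⟨div_nonneg (by linarith [hs.1]) ht1'.le,
          (div_le_one ht1').2 (by linarith [hs.2])⟩
          ((s' - t) / (1 - t)) ⟨div_nonneg (by linarith [hs'.1]) ht1'.le,
          (div_le_one ht1').2 (by linarith [hs'.2])⟩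
        rw [← sub_div, abs_div, abs_of_pos ht1', ← mul_div_assoc, sub_sub_sub_cancel_right] at h3
        refine h3.trans ((div_le_iff₀ ht1').2 ?_)
        calc _ ≤ (1 - t) * dist p q * |s - s'| := by gcongr
          _ = _ := by ring
  rw [← hct]
  exact hu _ _ hc hg ht

/-- Unique minimizing geodesics in a proper space depend continuously on their endpoints. -/
lemma HasUniqueMinGeodesic.tendsto_geod [ProperSpace X]
    (hgeo : ∀ p q : X, ∃ c : ℝ → X, IsMinGeodesic p q c) {p q : X} (hu : HasUniqueMinGeodesic p q)
    {ι : Type*} {l : Filter ι} {P P' : ι → X} {T : ι → ℝ} {t : ℝ} (hP : Tendsto P l (𝓝 p))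
    (hP' : Tendsto P' l (𝓝 q)) (hT : Tendsto T l (𝓝 t)) (hTI : ∀ᶠ i in l, T i ∈ Icc (0 : ℝ) 1)
    (ht : t ∈ Icc (0 : ℝ) 1) :
    Tendsto (fun i => geod (P i) (P' i) (T i)) l (𝓝 (geod p q t)) := by
  have h1 : ∀ᶠ i in l, dist (P i) (geod (P i) (P' i) (T i)) ≤ T i * dist (P i) (P' i) := by
    filter_upwards [hTI] with i hi
    have hg := isMinGeodesic_geod hgeo (P i) (P' i)
    have := hg.dist_le 0 ⟨le_rfl, zero_le_one⟩ (T i) hi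
    rwa [hg.map_zero, abs_sub_comm, sub_zero, abs_of_nonneg hi.1, mul_comm] at this
  have h2 : ∀ᶠ i in l, dist (geod (P i) (P' i) (T i)) (P' i) ≤ (1 - T i) * dist (P i) (P' i) := by
    filter_upwards [hTI] with i hi
    have hg := isMinGeodesic_geod hgeo (P i) (P' i)
    have := hg.dist_le (T i) hi 1 ⟨zero_le_one, le_rfl⟩
    rwa [hg.map_one, abs_sub_comm, abs_of_nonneg (by linarith [hi.2]), mul_comm] at this
  have hd := hP.dist hP'
  refine (isCompact_closedBall p (dist p q + 2)).tendsto_nhds_of_unique_mapClusterPt ?_ ?_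
  · filter_upwards [h1, hTI, hd.eventually_lt_const (lt_add_one _),
      hP (Metric.ball_mem_nhds p one_pos)] with i h1 hi h3 h4
    rw [Metric.mem_closedBall']
    have h4 : dist (P i) p < 1 := h4
    have h5 := dist_triangle_left p (geod (P i) (P' i) (T i)) (P i)
    have h6 : T i * dist (P i) (P' i) ≤ 1 * dist (P i) (P' i) := by gcongr; exact hi.2
    linarith
  · intro m _ hm
    obtain ⟨U, hU, hUm⟩ := mapClusterPt_iff_ultrafilter.1 hm
    refine hu.eq_geod hgeo ht ?_ ?_
    · exact le_of_tendsto_of_tendsto ((hP.mono_left hU).dist hUm)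
        ((hT.mono_left hU).mul (hd.mono_left hU)) (h1.filter_mono hU)
    · exact le_of_tendsto_of_tendsto (hUm.dist (hP'.mono_left hU))
        (((hT.mono_left hU).const_sub 1).mul (hd.mono_left hU)) (h2.filter_mono hU)

end MinGeodesic

/-- Locally unique minimizing geodesics are unique on a uniform scale near a compact set. -/
lemma exists_forall_hasUniqueMinGeodesic {X : Type*} [MetricSpace X]
    (hloc : ∀ x : X, ∃ ρ > 0, ∀ p ∈ Metric.ball x ρ, ∀ q ∈ Metric.ball x ρ,
      HasUniqueMinGeodesic p q) {K : Set X} (hK : IsCompact K) :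
    ∃ r > 0, ∀ p ∈ K, ∀ q, dist p q < r → HasUniqueMinGeodesic p q := by
  choose ρ hρ hu using hloc
  obtain ⟨r, hr, h⟩ := lebesgue_number_lemma_of_metric hK (c := fun x => Metric.ball x (ρ x))
    (fun _ => Metric.isOpen_ball) (fun x _ => mem_iUnion.2 ⟨x, Metric.mem_ball_self (hρ x)⟩)
  refine ⟨r, hr, fun p hp q hq => ?_⟩
  obtain ⟨x, hx⟩ := h p hp
  exact hu x p (hx (Metric.mem_ball_self hr)) q (hx (Metric.mem_ball'.2 hq))

section LipPaths

variable {X : Type*} [MetricSpace X]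

/-- The `L`-Lipschitz paths from `x` to `y`, extended to the real line by constants. -/
def lipPaths (x y : X) (L : ℝ) : Set C(ℝ, X) :=
  {c | (∀ t ≤ 0, c t = x) ∧ (∀ t, 1 ≤ t → c t = y) ∧ ∀ s t, dist (c s) (c t) ≤ L * |s - t|}

lemma lipPaths_nonneg {x y : X} {L : ℝ} {c : C(ℝ, X)} (hc : c ∈ lipPaths x y L) : 0 ≤ L := by
  have := hc.2.2 0 1
  simp only [zero_sub, abs_neg, abs_one, mul_one] at this
  exact dist_nonneg.trans this

lemma continuous_of_dist_le {f : ℝ → X} {L : ℝ} (hf : ∀ s t, dist (f s) (f t) ≤ L * |s - t|) :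
    Continuous f := by
  refine (LipschitzWith.of_dist_le_mul (K := L.toNNReal) fun s t => (hf s t).trans ?_).continuous
  rw [Real.dist_eq]
  gcongr
  exact Real.le_coe_toNNReal L

lemma dist_le_of_mem_lipPaths {x y : X} {L : ℝ} {c : C(ℝ, X)} (hc : c ∈ lipPaths x y L) (t : ℝ) :
    dist (c t) x ≤ L := by
  have hL := lipPaths_nonneg hc
  rcases le_total t 0 with h | h
  · rw [hc.1 t h, dist_self]; exact hL
  have h0 := hc.1 0 le_rfl
  rcases le_total t 1 with h1 | h1
  · have := hc.2.2 t 0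
    rw [h0, sub_zero, abs_of_nonneg h] at this
    nlinarith
  · have := hc.2.2 1 0
    rw [h0, sub_zero, abs_one, mul_one] at this
    rwa [hc.2.1 t h1, ← hc.2.1 1 le_rfl]

/-- A pointwise continuous family of `L`-Lipschitz paths is a path of paths. -/
lemma joinedIn_lipPaths {x y : X} {L : ℝ} {c c' : C(ℝ, X)} (H : unitInterval → ℝ → X)
    (h0 : ∀ t, H 0 t = c t) (h1 : ∀ t, H 1 t = c' t) (hx : ∀ s, ∀ t ≤ 0, H s t = x)
    (hy : ∀ s t, 1 ≤ t → H s t = y) (hL : ∀ s t t', dist (H s t) (H s t') ≤ L * |t - t'|)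
    (hc : ∀ t, Continuous fun s => H s t) : JoinedIn (lipPaths x y L) c c' := by
  have hcont : Continuous fun z : unitInterval × ℝ => H z.1 z.2 := by
    refine continuous_prod_of_continuous_lipschitzWith' _ L.toNNReal (fun s => ?_) hc
    refine LipschitzWith.of_dist_le_mul fun t t' => (hL s t t').trans ?_
    rw [Real.dist_eq]
    gcongr
    exact Real.le_coe_toNNReal L
  let F : C(unitInterval, C(ℝ, X)) := ContinuousMap.curry ⟨_, hcont⟩
  refine ⟨⟨F, ?_, ?_⟩, fun s => ⟨hx s, hy s, hL s⟩⟩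
  · ext t; exact h0 t
  · ext t; exact h1 t

/-- Replace the piece of the path `c` on `[a, b]` by a minimizing geodesic. -/
noncomputable def straighten (c : ℝ → X) (a b : ℝ) : ℝ → X := fun t =>
  if a ≤ t ∧ t ≤ b then geod (c a) (c b) ((t - a) / (b - a)) else c t

section Straighten

variable {c : ℝ → X} {a b t : ℝ}

lemma straighten_of_le (hgeo : ∀ p q : X, ∃ c : ℝ → X, IsMinGeodesic p q c) (ht : t ≤ a) :
    straighten c a b t = c t := by
  unfold straighten
  split_ifs with h
  · obtain rfl : t = a := le_antisymm ht h.1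
    rw [sub_self, zero_div, (isMinGeodesic_geod hgeo _ _).map_zero]
  · rfl

lemma straighten_of_ge (hgeo : ∀ p q : X, ∃ c : ℝ → X, IsMinGeodesic p q c) (ht : b ≤ t) :
    straighten c a b t = c t := by
  unfold straighten
  split_ifs with h
  · obtain rfl : t = b := le_antisymm h.2 ht
    rcases eq_or_lt_of_le h.1 with rfl | h'
    · rw [sub_self, zero_div, (isMinGeodesic_geod hgeo _ _).map_zero]
    · rw [div_self (sub_pos.2 h').ne', (isMinGeodesic_geod hgeo _ _).map_one]
  · rfl

lemma straighten_of_mem (ha : a ≤ t) (hb : t ≤ b) :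
    straighten c a b t = geod (c a) (c b) ((t - a) / (b - a)) := if_pos ⟨ha, hb⟩

lemma dist_straighten_le (hgeo : ∀ p q : X, ∃ c : ℝ → X, IsMinGeodesic p q c) {L : ℝ}
    (hc : ∀ s t, dist (c s) (c t) ≤ L * |s - t|) (hab : a ≤ b) (s t : ℝ) :
    dist (straighten c a b s) (straighten c a b t) ≤ L * |s - t| := by
  refine dist_le_mul_abs_glue (a := min (min s t) a) (b := a) (c := max (max s t) b)
    (fun s hs t ht => ?_) (dist_le_mul_abs_glue (b := b) (fun s hs t ht => ?_)
    (fun s hs t ht => ?_)) s ?_ t ?_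
  · rw [straighten_of_le hgeo hs.2, straighten_of_le hgeo ht.2]; exact hc s t
  · rw [straighten_of_mem hs.1 hs.2, straighten_of_mem ht.1 ht.2]
    rcases eq_or_lt_of_le hab with rfl | hab
    · simp only [sub_self, div_zero, dist_self]
      exact dist_nonneg.trans (hc s t)
    have hba := sub_pos.2 hab
    have h := (isMinGeodesic_geod hgeo (c a) (c b)).dist_le ((s - a) / (b - a))
      ⟨div_nonneg (sub_nonneg.2 hs.1) hba.le, (div_le_one hba).2 (by linarith [hs.2])⟩
      ((t - a) / (b - a))
      ⟨div_nonneg (sub_nonneg.2 ht.1) hba.le, (div_le_one hba).2 (by linarith [ht.2])⟩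
    rw [← sub_div, abs_div, abs_of_pos hba, sub_sub_sub_cancel_right, ← mul_div_assoc] at h
    refine h.trans ((div_le_iff₀ hba).2 ?_)
    have h2 := hc a b
    rw [abs_sub_comm, abs_of_pos hba] at h2
    calc _ ≤ L * (b - a) * |s - t| := by gcongr
      _ = _ := by ring
  · rw [straighten_of_ge hgeo hs.1, straighten_of_ge hgeo ht.1]; exact hc s t
  · exact ⟨(min_le_left _ _).trans (min_le_left _ _), (le_max_left _ _).trans (le_max_left _ _)⟩
  · exact ⟨(min_le_left _ _).trans (min_le_right _ _), (le_max_right _ _).trans (le_max_left _ _)⟩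

end Straighten

/-- Straightening a piece of a path with unique geodesics is a deformation through Lipschitz
paths. -/
lemma exists_joinedIn_straighten [ProperSpace X]
    (hgeo : ∀ p q : X, ∃ c : ℝ → X, IsMinGeodesic p q c) {x y : X} {L : ℝ} {c : C(ℝ, X)}
    (hc : c ∈ lipPaths x y L) {a b : ℝ} (ha : 0 ≤ a) (hab : a ≤ b) (hb : b ≤ 1)
    (hu : ∀ t ∈ Icc a b, HasUniqueMinGeodesic (c a) (c t)) :
    ∃ c' : C(ℝ, X), ⇑c' = straighten c a b ∧ JoinedIn (lipPaths x y L) c c' := by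
  let m : unitInterval → ℝ := fun s => a + s * (b - a)
  have hm : Continuous m := by fun_prop
  have hma : ∀ s, a ≤ m s := fun s => by
    have := mul_nonneg s.2.1 (sub_nonneg.2 hab); simp only [m]; linarith
  have hmb : ∀ s, m s ≤ b := fun s => by
    have := mul_le_mul_of_nonneg_right s.2.2 (sub_nonneg.2 hab); simp only [m]; linarith
  have hL : ∀ s t t', dist (straighten c a (m s) t) (straighten c a (m s) t') ≤ L * |t - t'| :=
    fun s t t' => dist_straighten_le hgeo hc.2.2 (hma s) t t'
  let c' : C(ℝ, X) := ⟨straighten c a (m 1), continuous_of_dist_le (hL 1)⟩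
  have hm1 : m 1 = b := by simp [m]
  refine ⟨c', by rw [← hm1]; rfl, joinedIn_lipPaths (fun s => straighten c a (m s)) (fun t => ?_)
    (fun t => rfl) (fun s t ht => ?_) (fun s t ht => ?_) hL fun t => ?_⟩
  · have hm0 : m 0 = a := by simp [m]
    rw [hm0]
    rcases le_total t a with h | h
    · exact straighten_of_le hgeo h
    · exact straighten_of_ge hgeo h
  · rw [straighten_of_le hgeo (ht.trans ha)]; exact hc.1 t ht
  · rw [straighten_of_ge hgeo ((hmb s).trans (hb.trans ht))]; exact hc.2.1 t ht
  · rcases le_or_gt t a with hta | hta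
    · simp only [straighten_of_le hgeo hta]; exact continuous_const
    rcases le_or_gt b t with htb | htb
    · have heq : ∀ s, straighten c a (m s) t = c t := fun s =>
        straighten_of_ge hgeo ((hmb s).trans htb)
      simp only [heq]; exact continuous_const
    have heq : ∀ s, straighten c a (m s) t =
        geod (c a) (c (max (m s) t)) ((t - a) / (max (m s) t - a)) := by
      intro s
      rcases le_total t (m s) with h | h
      · rw [max_eq_left h, straighten_of_mem hta.le h]
      · rw [max_eq_right h, straighten_of_ge hgeo h, div_self (sub_pos.2 hta).ne',
          (isMinGeodesic_geod hgeo _ _).map_one]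
    simp only [heq]
    have hpos : ∀ s, 0 < max (m s) t - a := fun s => by
      have := le_max_right (m s) t; linarith
    have hI : ∀ s, (t - a) / (max (m s) t - a) ∈ Icc (0 : ℝ) 1 := fun s =>
      ⟨div_nonneg (sub_pos.2 hta).le (hpos s).le,
        (div_le_one (hpos s)).2 (sub_le_sub_right (le_max_right _ _) _)⟩
    refine continuous_iff_continuousAt.2 fun s => ?_
    refine (hu (max (m s) t) ⟨(hma s).trans (le_max_left _ _),
      max_le (hmb s) htb.le⟩).tendsto_geod hgeo tendsto_const_nhds ?_ ?_ (.of_forall hI) (hI s)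
    · have : Continuous fun s => c (max (m s) t) := by fun_prop
      exact this.tendsto s
    · have : Continuous fun s => (t - a) / (max (m s) t - a) :=
        continuous_const.div (by fun_prop) fun s => (hpos s).ne'
      exact this.tendsto s

/-- The broken geodesic on `[0, 1]` with vertices `p 0, …, p N`. -/
noncomputable def brokenGeod (N : ℕ) (p : ℕ → X) (t : ℝ) : X :=
  geod (p ⌊N * (projIcc (0 : ℝ) 1 zero_le_one t : ℝ)⌋₊)
    (p (⌊N * (projIcc (0 : ℝ) 1 zero_le_one t : ℝ)⌋₊ + 1))
    (N * (projIcc (0 : ℝ) 1 zero_le_one t : ℝ) - ⌊N * (projIcc (0 : ℝ) 1 zero_le_one t : ℝ)⌋₊)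

section BrokenGeod

variable {N : ℕ} {p : ℕ → X} {L : ℝ}

lemma natCast_div_mem_Icc {N i : ℕ} (hN : 0 < N) (hi : i ≤ N) : (i : ℝ) / N ∈ Icc (0 : ℝ) 1 :=
  ⟨by positivity, (div_le_one (by exact_mod_cast hN)).2 (by exact_mod_cast hi)⟩

lemma brokenGeod_natCast_div (hgeo : ∀ p q : X, ∃ c : ℝ → X, IsMinGeodesic p q c) (hN : 0 < N)
    {i : ℕ} (hi : i ≤ N) : brokenGeod N p ((i : ℝ) / N) = p i := by
  have hN' : (N : ℝ) ≠ 0 := by exact_mod_cast hN.ne'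
  unfold brokenGeod
  rw [projIcc_of_mem zero_le_one (natCast_div_mem_Icc hN hi)]
  simp only [mul_div_cancel₀ _ hN', Nat.floor_natCast, sub_self,
    (isMinGeodesic_geod hgeo _ _).map_zero]

lemma brokenGeod_of_mem (hgeo : ∀ p q : X, ∃ c : ℝ → X, IsMinGeodesic p q c) (hN : 0 < N)
    {i : ℕ} (hi : i < N) {t : ℝ} (ht : t ∈ Icc ((i : ℝ) / N) (((i + 1 : ℕ) : ℝ) / N)) :
    brokenGeod N p t = geod (p i) (p (i + 1)) (N * t - i) := by
  have hN' : (0 : ℝ) < N := by exact_mod_cast hN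
  rcases eq_or_lt_of_le ht.2 with rfl | h
  · rw [brokenGeod_natCast_div hgeo hN hi, mul_div_cancel₀ _ hN'.ne']
    push_cast
    rw [add_sub_cancel_left, (isMinGeodesic_geod hgeo _ _).map_one]
  · have ht' : t ∈ Icc (0 : ℝ) 1 := ⟨(natCast_div_mem_Icc hN hi.le).1.trans ht.1,
      ht.2.trans (natCast_div_mem_Icc hN hi).2⟩
    have hfl : ⌊N * t⌋₊ = i := by
      rw [Nat.floor_eq_iff (mul_nonneg hN'.le ht'.1)]
      have h1 := (div_le_iff₀ hN').1 ht.1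
      have h2 := (lt_div_iff₀ hN').1 h
      push_cast at h2
      constructor <;> linarith
    unfold brokenGeod
    rw [projIcc_of_mem zero_le_one ht']
    simp only [hfl]

lemma dist_brokenGeod_le (hgeo : ∀ p q : X, ∃ c : ℝ → X, IsMinGeodesic p q c) (hN : 0 < N)
    (hL0 : 0 ≤ L) (hp : ∀ i < N, N * dist (p i) (p (i + 1)) ≤ L) (s t : ℝ) :
    dist (brokenGeod N p s) (brokenGeod N p t) ≤ L * |s - t| := by
  have hN' : (0 : ℝ) < N := by exact_mod_cast hN
  have key : ∀ k ≤ N, ∀ s ∈ Icc (0 : ℝ) ((k : ℝ) / N), ∀ t ∈ Icc (0 : ℝ) ((k : ℝ) / N),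
      dist (brokenGeod N p s) (brokenGeod N p t) ≤ L * |s - t| := by
    intro k
    induction k with
    | zero =>
      intro _ s hs t ht
      simp only [Nat.cast_zero, zero_div, Icc_self, mem_singleton_iff] at hs ht
      simp [hs, ht]
    | succ k ih =>
      intro hk
      refine dist_le_mul_abs_glue (ih (by omega)) fun s hs t ht => ?_
      rw [brokenGeod_of_mem hgeo hN hk hs, brokenGeod_of_mem hgeo hN hk ht]
      have hI : ∀ s ∈ Icc ((k : ℝ) / N) (((k + 1 : ℕ) : ℝ) / N), N * s - k ∈ Icc (0 : ℝ) 1 := by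
        intro s hs
        have h1 := (div_le_iff₀ hN').1 hs.1
        have h2 := (le_div_iff₀ hN').1 hs.2
        push_cast at h2
        constructor <;> linarith
      refine ((isMinGeodesic_geod hgeo _ _).dist_le _ (hI s hs) _ (hI t ht)).trans ?_
      rw [sub_sub_sub_cancel_right, ← mul_sub, abs_mul, abs_of_pos hN', ← mul_assoc,
        mul_comm (dist _ _)]
      gcongr
      exact hp k hk
  have h1 := key N le_rfl _ (by rw [div_self hN'.ne']; exact (projIcc (0 : ℝ) 1 zero_le_one s).2) _
    (by rw [div_self hN'.ne']; exact (projIcc (0 : ℝ) 1 zero_le_one t).2)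
  have h2 : ∀ s, brokenGeod N p (projIcc (0 : ℝ) 1 zero_le_one s : ℝ) = brokenGeod N p s := by
    intro s; unfold brokenGeod; simp only [projIcc_val]
  rw [h2, h2] at h1
  refine h1.trans ?_
  have h3 := (LipschitzWith.projIcc (zero_le_one (α := ℝ))).dist_le_mul s t
  rw [Subtype.dist_eq, Real.dist_eq, Real.dist_eq, NNReal.coe_one, one_mul] at h3
  gcongr

lemma brokenGeod_of_le_zero (hgeo : ∀ p q : X, ∃ c : ℝ → X, IsMinGeodesic p q c) {t : ℝ}
    (ht : t ≤ 0) : brokenGeod N p t = p 0 := by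
  unfold brokenGeod
  rw [projIcc_of_le_left zero_le_one ht]
  simp [(isMinGeodesic_geod hgeo _ _).map_zero]

lemma brokenGeod_of_one_le (hgeo : ∀ p q : X, ∃ c : ℝ → X, IsMinGeodesic p q c) {t : ℝ}
    (ht : 1 ≤ t) : brokenGeod N p t = p N := by
  unfold brokenGeod
  rw [projIcc_of_right_le zero_le_one ht]
  simp [(isMinGeodesic_geod hgeo _ _).map_zero]

lemma exists_mem_lipPaths_brokenGeod (hgeo : ∀ p q : X, ∃ c : ℝ → X, IsMinGeodesic p q c)
    (hN : 0 < N) (hL0 : 0 ≤ L) (hp : ∀ i < N, N * dist (p i) (p (i + 1)) ≤ L) :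
    ∃ c ∈ lipPaths (p 0) (p N) L, ⇑c = brokenGeod N p :=
  ⟨⟨brokenGeod N p, continuous_of_dist_le (dist_brokenGeod_le hgeo hN hL0 hp)⟩,
    ⟨fun _ ht => brokenGeod_of_le_zero hgeo ht, fun _ ht => brokenGeod_of_one_le hgeo ht,
      dist_brokenGeod_le hgeo hN hL0 hp⟩, rfl⟩

end BrokenGeod

end LipPaths

section Shortening

variable {X : Type*} [MetricSpace X]

/-- Local geodesics, as functions on the real line restricted to `[0, 1]`. -/
def IsLocalGeodesic (c : ℝ → X) : Prop :=
  ∃ v : ℝ, 0 ≤ v ∧ ∀ t ∈ Icc (0 : ℝ) 1, ∃ δ > 0, ∀ s ∈ Icc (0 : ℝ) 1, ∀ s' ∈ Icc (0 : ℝ) 1,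
    |s - t| < δ → |s' - t| < δ → dist (c s) (c s') = v * |s - s'|

/-- The vertices of a path at the multiples of `1 / N`. -/
noncomputable def vertices (N : ℕ) (c : C(ℝ, X)) : ℕ → X := fun i => c ((i : ℝ) / N)

/-- The energy of a broken geodesic with vertices `p 0, …, p N`, up to normalization. -/
noncomputable def vertexEnergy (N : ℕ) (p : ℕ → X) : ℝ :=
  ∑ i ∈ Finset.range N, dist (p i) (p (i + 1)) ^ 2

/-- Move the vertex `i + 1` to the midpoint of its neighbours. -/
noncomputable def recentre (i : ℕ) (p : ℕ → X) : ℕ → X :=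
  Function.update p (i + 1) (geod (p i) (p (i + 2)) 2⁻¹)

lemma continuous_vertexEnergy (N : ℕ) : Continuous (vertexEnergy N : (ℕ → X) → ℝ) := by
  unfold vertexEnergy
  fun_prop

lemma vertexEnergy_recentre (hgeo : ∀ p q : X, ∃ c : ℝ → X, IsMinGeodesic p q c) {N i : ℕ}
    (hi : i + 2 ≤ N) (p : ℕ → X) :
    vertexEnergy N (recentre i p) = vertexEnergy N p + (dist (p i) (p (i + 2)) ^ 2 / 2 -
      (dist (p i) (p (i + 1)) ^ 2 + dist (p (i + 1)) (p (i + 2)) ^ 2)) := by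
  have hg := isMinGeodesic_geod hgeo (p i) (p (i + 2))
  have h2 : (2⁻¹ : ℝ) ∈ Icc (0 : ℝ) 1 := by constructor <;> norm_num
  have e1 : dist (p i) (geod (p i) (p (i + 2)) 2⁻¹) = dist (p i) (p (i + 2)) / 2 := by
    have := hg.dist_eq ⟨le_rfl, zero_le_one⟩ h2
    rw [hg.map_zero] at this
    rw [this, zero_sub, abs_neg, abs_of_pos (by norm_num), div_eq_mul_inv]
  have e2 : dist (geod (p i) (p (i + 2)) 2⁻¹) (p (i + 2)) = dist (p i) (p (i + 2)) / 2 := by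
    have := hg.dist_eq h2 ⟨zero_le_one, le_rfl⟩
    rw [hg.map_one] at this
    rw [this]; norm_num [abs_of_neg]; ring
  have hsub : ({i, i + 1} : Finset ℕ) ⊆ Finset.range N := by
    intro j hj
    simp only [Finset.mem_insert, Finset.mem_singleton] at hj
    rw [Finset.mem_range]; omega
  rw [← sub_eq_iff_eq_add', vertexEnergy, vertexEnergy, ← Finset.sum_sub_distrib,
    ← Finset.sum_subset hsub, Finset.sum_pair (by omega)]
  · simp only [recentre, Function.update_self, Function.update_of_ne (show i ≠ i + 1 by omega),
      Function.update_of_ne (show i + 1 + 1 ≠ i + 1 by omega), e1, e2]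
    ring
  · intro j _ hj
    simp only [Finset.mem_insert, Finset.mem_singleton, not_or] at hj
    simp only [recentre, Function.update_of_ne (show j ≠ i + 1 from hj.2),
      Function.update_of_ne (show j + 1 ≠ i + 1 by omega), sub_self]

/-- A chain with equal edges whose consecutive triples are aligned spans a local geodesic. -/
lemma isLocalGeodesic_brokenGeod (hgeo : ∀ p q : X, ∃ c : ℝ → X, IsMinGeodesic p q c) {N : ℕ}
    (hN : 2 ≤ N) {p : ℕ → X} {v : ℝ} (hv : 0 ≤ v)
    (h1 : ∀ i < N, N * dist (p i) (p (i + 1)) = v)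
    (h2 : ∀ i, i + 2 ≤ N → N * dist (p i) (p (i + 2)) = 2 * v) :
    IsLocalGeodesic (brokenGeod N p) := by
  have hN0 : 0 < N := by omega
  have hN' : (0 : ℝ) < N := by exact_mod_cast hN0
  have hLip := dist_brokenGeod_le hgeo hN0 hv (fun i hi => (h1 i hi).le)
  have key : ∀ i, i + 2 ≤ N → ∀ s s', (i : ℝ) / N ≤ s → s ≤ s' → s' ≤ ((i + 2 : ℕ) : ℝ) / N →
      dist (brokenGeod N p s) (brokenGeod N p s') = v * |s - s'| := by
    intro i hi s s' hs hss hs'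
    refine le_antisymm (hLip s s') ?_
    have a1 := hLip ((i : ℝ) / N) s
    have a2 := hLip s' (((i + 2 : ℕ) : ℝ) / N)
    have a3 := dist_triangle4 (brokenGeod N p ((i : ℝ) / N)) (brokenGeod N p s)
      (brokenGeod N p s') (brokenGeod N p (((i + 2 : ℕ) : ℝ) / N))
    rw [abs_sub_comm, abs_of_nonneg (by linarith)] at a1 a2 ⊢
    rw [brokenGeod_natCast_div hgeo hN0 (by omega)] at a1 a3
    rw [brokenGeod_natCast_div hgeo hN0 hi] at a2 a3
    have a4 : dist (p i) (p (i + 2)) = v * (((i + 2 : ℕ) : ℝ) / N) - v * ((i : ℝ) / N) := by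
      have := h2 i hi
      push_cast
      field_simp
      linarith
    linarith
  refine ⟨v, hv, fun t ht => ?_⟩
  set j := ⌊N * t⌋₊ with hj
  have hj1 : (j : ℝ) ≤ N * t := Nat.floor_le (mul_nonneg hN'.le ht.1)
  have hj2 : N * t < (j : ℝ) + 1 := Nat.lt_floor_add_one _
  set i := min (j - 1) (N - 2) with hi
  have hiN : i + 2 ≤ N := by omega
  refine ⟨min (1 / (N : ℝ)) (((j : ℝ) + 1) / N - t), lt_min (by positivity) ?_, ?_⟩
  · rw [sub_pos, lt_div_iff₀ hN']; linarith
  have hI : ∀ s ∈ Icc (0 : ℝ) 1, |s - t| < min (1 / (N : ℝ)) (((j : ℝ) + 1) / N - t) →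
      (i : ℝ) / N ≤ s ∧ s ≤ ((i + 2 : ℕ) : ℝ) / N := by
    intro s hs hst
    rw [lt_min_iff] at hst
    have b1 := (abs_lt.1 hst.1).1
    have b2 := (abs_lt.1 hst.2).2
    constructor
    · rcases Nat.eq_zero_or_pos i with h | h
      · rw [h]; simpa using hs.1
      · have : (i : ℝ) + 1 ≤ j := by exact_mod_cast (by omega : i + 1 ≤ j)
        rw [div_le_iff₀ hN']
        have b3 : -1 < (s - t) * N := by
          have := mul_lt_mul_of_pos_right b1 hN'
          rwa [neg_mul, one_div, inv_mul_cancel₀ hN'.ne'] at this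
        linarith
    · rcases le_or_gt (N - 2) (j - 1) with h | h
      · have : i + 2 = N := by omega
        rw [this, div_self hN'.ne']; exact hs.2
      · have : (j : ℝ) + 1 ≤ ((i + 2 : ℕ) : ℝ) := by exact_mod_cast (by omega : j + 1 ≤ i + 2)
        have b3 : ((j : ℝ) + 1) / N ≤ ((i + 2 : ℕ) : ℝ) / N := by gcongr
        linarith
  intro s hs s' hs' hst hst'
  have c1 := hI s hs hst
  have c2 := hI s' hs' hst'
  rcases le_total s s' with h | h
  · exact key i hiN s s' c1.1 h c2.2
  · rw [dist_comm, abs_sub_comm]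
    exact key i hiN s' s c2.1 h c1.2

variable {x y : X} {L r : ℝ} {N : ℕ}

lemma hasUniqueMinGeodesic_of_mem_lipPaths (hN : 0 < N)
    (hr : ∀ p ∈ Metric.closedBall x L, ∀ q, dist p q < r → HasUniqueMinGeodesic p q)
    (hNr : 2 * L < r * N) {c : C(ℝ, X)} (hc : c ∈ lipPaths x y L) {s t : ℝ}
    (hst : |s - t| ≤ 2 / N) : HasUniqueMinGeodesic (c s) (c t) := by
  have hN' : (0 : ℝ) < N := by exact_mod_cast hN
  refine hr _ (dist_le_of_mem_lipPaths hc s) _ ((hc.2.2 s t).trans_lt ?_)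
  have hL := lipPaths_nonneg hc
  calc L * |s - t| ≤ L * (2 / N) := by gcongr
    _ < r := by rw [mul_div_assoc', div_lt_iff₀ hN']; linarith

lemma natCast_mul_dist_vertices_le (hN : 0 < N) {c : C(ℝ, X)} (hc : c ∈ lipPaths x y L) (i : ℕ) :
    N * dist (vertices N c i) (vertices N c (i + 1)) ≤ L := by
  have hN' : (0 : ℝ) < N := by exact_mod_cast hN
  have := hc.2.2 ((i : ℝ) / N) (((i + 1 : ℕ) : ℝ) / N)
  rw [← sub_div, Nat.cast_succ, sub_add_cancel_left, neg_div, abs_neg, abs_of_pos (by positivity),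
    mul_one_div, le_div_iff₀ hN'] at this
  rw [mul_comm]
  simpa [vertices] using this

lemma vertices_zero {c : C(ℝ, X)} (hc : c ∈ lipPaths x y L) : vertices N c 0 = x := by
  simp [vertices, hc.1 0 le_rfl]

lemma vertices_self (hN : 0 < N) {c : C(ℝ, X)} (hc : c ∈ lipPaths x y L) :
    vertices N c N = y := by
  have hN' : (0 : ℝ) < N := by exact_mod_cast hN
  simp [vertices, div_self hN'.ne', hc.2.1 1 le_rfl]

lemma JoinedIn.mem_lipPaths {c c' : C(ℝ, X)} (h : JoinedIn (lipPaths x y L) c c') :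
    c' ∈ lipPaths x y L := h.target_mem

/-- A Lipschitz path can be deformed to the broken geodesic with the same vertices. -/
lemma exists_joinedIn_brokenGeod [ProperSpace X]
    (hgeo : ∀ p q : X, ∃ c : ℝ → X, IsMinGeodesic p q c) (hN : 0 < N)
    (hr : ∀ p ∈ Metric.closedBall x L, ∀ q, dist p q < r → HasUniqueMinGeodesic p q)
    (hNr : 2 * L < r * N) {c : C(ℝ, X)} (hc : c ∈ lipPaths x y L) :
    ∃ c' : C(ℝ, X), ⇑c' = brokenGeod N (vertices N c) ∧ JoinedIn (lipPaths x y L) c c' := by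
  have hN' : (0 : ℝ) < N := by exact_mod_cast hN
  have key : ∀ k ≤ N, ∃ c' : C(ℝ, X), JoinedIn (lipPaths x y L) c c' ∧
      (∀ t, (k : ℝ) / N ≤ t → c' t = c t) ∧
      ∀ t ∈ Icc (0 : ℝ) ((k : ℝ) / N), c' t = brokenGeod N (vertices N c) t := by
    intro k
    induction k with
    | zero =>
      intro _
      refine ⟨c, JoinedIn.refl hc, fun _ _ => rfl, fun t ht => ?_⟩
      have : t = 0 := by simpa using ht
      rw [this, hc.1 0 le_rfl, brokenGeod_of_le_zero hgeo le_rfl, vertices_zero hc]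
    | succ k ih =>
      intro hk
      obtain ⟨c', hj, hc1, hc2⟩ := ih (by omega)
      have hkk : (k : ℝ) / N ≤ ((k + 1 : ℕ) : ℝ) / N := by gcongr; omega
      obtain ⟨c'', he, hj'⟩ := exists_joinedIn_straighten hgeo hj.mem_lipPaths (a := (k : ℝ) / N)
        (b := ((k + 1 : ℕ) : ℝ) / N) (by positivity) hkk (natCast_div_mem_Icc hN hk).2
        (fun t ht => hasUniqueMinGeodesic_of_mem_lipPaths hN hr hNr hj.mem_lipPaths (by
          rw [abs_sub_comm, abs_of_nonneg (sub_nonneg.2 ht.1)]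
          have := ht.2
          push_cast at this
          have h2 : ((k : ℝ) + 1) / N = k / N + 1 / N := add_div _ _ _
          have h3 : (2 : ℝ) / N = 1 / N + 1 / N := by ring
          have h4 : (0 : ℝ) < 1 / N := by positivity
          linarith))
      refine ⟨c'', hj.trans hj', fun t ht => ?_, fun t ht => ?_⟩
      · rw [he, straighten_of_ge hgeo ht]
        exact hc1 t (hkk.trans ht)
      · rw [he]
        rcases le_total t ((k : ℝ) / N) with h | h
        · rw [straighten_of_le hgeo h]; exact hc2 t ⟨ht.1, h⟩
        · rw [straighten_of_mem h ht.2, brokenGeod_of_mem hgeo hN hk ⟨h, ht.2⟩, hc1 _ le_rfl,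
            hc1 _ hkk]
          simp only [vertices]
          congr 1
          push_cast
          field_simp
          ring
  obtain ⟨c', hj, hc1, hc2⟩ := key N le_rfl
  rw [div_self hN'.ne'] at hc1 hc2
  refine ⟨c', ?_, hj⟩
  ext t
  rcases le_total t 0 with h | h
  · rw [hj.mem_lipPaths.1 t h, brokenGeod_of_le_zero hgeo h, vertices_zero hc]
  rcases le_total t 1 with h1 | h1
  · exact hc2 t ⟨h, h1⟩
  · rw [hj.mem_lipPaths.2.1 t h1, brokenGeod_of_one_le hgeo h1, vertices_self hN hc]

/-- Recentring a vertex is realized by a deformation. -/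
lemma exists_joinedIn_recentre [ProperSpace X]
    (hgeo : ∀ p q : X, ∃ c : ℝ → X, IsMinGeodesic p q c) (hN : 0 < N)
    (hr : ∀ p ∈ Metric.closedBall x L, ∀ q, dist p q < r → HasUniqueMinGeodesic p q)
    (hNr : 2 * L < r * N) {c : C(ℝ, X)} (hc : c ∈ lipPaths x y L) {i : ℕ} (hi : i + 2 ≤ N) :
    ∃ c' : C(ℝ, X), vertices N c' = recentre i (vertices N c) ∧
      JoinedIn (lipPaths x y L) c c' := by
  have hN' : (0 : ℝ) < N := by exact_mod_cast hN
  have hkk : (i : ℝ) / N ≤ ((i + 2 : ℕ) : ℝ) / N := by gcongr; omega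
  obtain ⟨c', he, hj⟩ := exists_joinedIn_straighten hgeo hc (a := (i : ℝ) / N)
    (b := ((i + 2 : ℕ) : ℝ) / N) (by positivity) hkk (natCast_div_mem_Icc hN hi).2
    (fun t ht => hasUniqueMinGeodesic_of_mem_lipPaths hN hr hNr hc (by
      rw [abs_sub_comm, abs_of_nonneg (sub_nonneg.2 ht.1)]
      have := ht.2
      push_cast at this
      rw [add_div] at this
      linarith))
  refine ⟨c', ?_, hj⟩
  ext j
  simp only [recentre]
  rcases lt_trichotomy j (i + 1) with h | rfl | h
  · rw [Function.update_of_ne h.ne, vertices, he, straighten_of_le hgeo (by gcongr; omega)]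
    rfl
  · rw [Function.update_self, vertices, he, straighten_of_mem (by gcongr; omega)
      (by gcongr; omega)]
    simp only [vertices]
    congr 1
    push_cast
    field_simp
    ring
  · rw [Function.update_of_ne h.ne', vertices, he, straighten_of_ge hgeo (by gcongr; omega)]
    rfl

/-- Broken geodesics with nearby vertices are joined by moving the vertices along geodesics. -/
lemma joinedIn_brokenGeod_of_moved [ProperSpace X]
    (hgeo : ∀ p q : X, ∃ c : ℝ → X, IsMinGeodesic p q c) (hN : 0 < N) (hL0 : 0 ≤ L)
    (hr : ∀ p ∈ Metric.closedBall x L, ∀ q, dist p q < r → HasUniqueMinGeodesic p q)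
    (hNr : 2 * L < r * N) {p q : ℕ → X} (hp0 : p 0 = x) (hpN : p N = y) (hq0 : q 0 = x)
    (hqN : q N = y) (hpq : ∀ i ≤ N, HasUniqueMinGeodesic (p i) (q i))
    (hmove : ∀ s ∈ Icc (0 : ℝ) 1, ∀ i < N,
      N * dist (geod (p i) (q i) s) (geod (p (i + 1)) (q (i + 1)) s) ≤ L)
    {c c' : C(ℝ, X)} (hc : ⇑c = brokenGeod N p) (hc' : ⇑c' = brokenGeod N q) :
    JoinedIn (lipPaths x y L) c c' := by
  have hN' : (0 : ℝ) < N := by exact_mod_cast hN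
  let P : unitInterval → ℕ → X := fun s i => geod (p i) (q i) s
  have hP0 : ∀ s, P s 0 = x := fun s => by
    have := (isMinGeodesic_geod hgeo (p 0) (q 0)).dist_le 0 ⟨le_rfl, zero_le_one⟩ s s.2
    rw [(isMinGeodesic_geod hgeo (p 0) (q 0)).map_zero, hp0, hq0, dist_self, zero_mul] at this
    simpa only [P, hp0, hq0] using (dist_le_zero.1 this).symm
  have hPN : ∀ s, P s N = y := fun s => by
    have := (isMinGeodesic_geod hgeo (p N) (q N)).dist_le 0 ⟨le_rfl, zero_le_one⟩ s s.2
    rw [(isMinGeodesic_geod hgeo (p N) (q N)).map_zero, hpN, hqN, dist_self, zero_mul] at this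
    simpa only [P, hpN, hqN] using (dist_le_zero.1 this).symm
  have hPL : ∀ s, ∀ i < N, N * dist (P s i) (P s (i + 1)) ≤ L := fun s i hi => hmove s s.2 i hi
  have hPc : ∀ i ≤ N, Continuous fun s => P s i := fun i hi =>
    continuous_iff_continuousAt.2 fun s => (hpq i hi).tendsto_geod hgeo tendsto_const_nhds
      tendsto_const_nhds continuous_subtype_val.continuousAt (.of_forall fun s => s.2) s.2
  refine joinedIn_lipPaths (fun s t => brokenGeod N (P s) t) (fun t => ?_) (fun t => ?_)
    (fun s t ht => ?_) (fun s t ht => ?_) (fun s => dist_brokenGeod_le hgeo hN hL0 (hPL s))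
    (fun t => ?_)
  · have : P 0 = p := funext fun i => (isMinGeodesic_geod hgeo (p i) (q i)).map_zero
    rw [this, hc]
  · have : P 1 = q := funext fun i => (isMinGeodesic_geod hgeo (p i) (q i)).map_one
    rw [this, hc']
  · rw [brokenGeod_of_le_zero hgeo ht, hP0]
  · rw [brokenGeod_of_one_le hgeo ht, hPN]
  · rcases le_or_gt t 0 with h | h
    · simp only [brokenGeod_of_le_zero hgeo h, hP0]; exact continuous_const
    rcases le_or_gt 1 t with h1 | h1
    · simp only [brokenGeod_of_one_le hgeo h1, hPN]; exact continuous_const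
    set i := ⌊N * t⌋₊ with hi
    have hj1 : (i : ℝ) ≤ N * t := Nat.floor_le (by positivity)
    have hj2 : N * t < (i : ℝ) + 1 := Nat.lt_floor_add_one _
    have hiN : i < N := by
      have : (i : ℝ) < N := hj1.trans_lt (by nlinarith)
      exact_mod_cast this
    have ht : t ∈ Icc ((i : ℝ) / N) (((i + 1 : ℕ) : ℝ) / N) :=
      ⟨(div_le_iff₀ hN').2 (by linarith), (le_div_iff₀ hN').2 (by push_cast; linarith)⟩
    simp only [brokenGeod_of_mem hgeo hN hiN ht]
    have hTI : N * t - i ∈ Icc (0 : ℝ) 1 := by constructor <;> linarith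
    refine continuous_iff_continuousAt.2 fun s => ?_
    have hu : HasUniqueMinGeodesic (P s i) (P s (i + 1)) := by
      obtain ⟨d, hd, hde⟩ := exists_mem_lipPaths_brokenGeod hgeo hN hL0 (hPL s)
      rw [hP0, hPN] at hd
      have := hasUniqueMinGeodesic_of_mem_lipPaths hN hr hNr hd (s := (i : ℝ) / N)
        (t := ((i + 1 : ℕ) : ℝ) / N) (by
          rw [← sub_div, Nat.cast_succ, sub_add_cancel_left, neg_div, abs_neg,
            abs_of_pos (by positivity)]
          gcongr
          norm_num)
      rwa [hde, brokenGeod_natCast_div hgeo hN hiN.le, brokenGeod_natCast_div hgeo hN hiN] at this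
    exact hu.tendsto_geod hgeo ((hPc i hiN.le).tendsto s) ((hPc (i + 1) hiN).tendsto s)
      tendsto_const_nhds (.of_forall fun _ => hTI) hTI

end Shortening

section EnergyMinimizer

variable {X : Type*} [MetricSpace X] {x y : X} {L r : ℝ} {N : ℕ}

/-- The vertices of the Lipschitz paths in the deformation class of `c`. -/
def vertexClass (x y : X) (L : ℝ) (N : ℕ) (c : C(ℝ, X)) : Set (ℕ → X) :=
  vertices N '' {c' | JoinedIn (lipPaths x y L) c c'}

lemma closure_vertexClass_subset (hN : 0 < N) (c : C(ℝ, X)) :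
    closure (vertexClass x y L N c) ⊆ {p | p 0 = x ∧ p N = y ∧
      (∀ i, N * dist (p i) (p (i + 1)) ≤ L) ∧ ∀ i, dist (p i) x ≤ L} := by
  refine closure_minimal ?_ ?_
  · rintro _ ⟨c', hc', rfl⟩
    have h := hc'.mem_lipPaths
    exact ⟨vertices_zero h, vertices_self hN h, natCast_mul_dist_vertices_le hN h,
      fun i => dist_le_of_mem_lipPaths h _⟩
  · simp only [ofPred_and, ofPred_forall]
    refine (isClosed_eq (by fun_prop) continuous_const).inter
      ((isClosed_eq (by fun_prop) continuous_const).inter (IsClosed.inter ?_ ?_))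
    · exact isClosed_iInter fun i => isClosed_le (by fun_prop) continuous_const
    · exact isClosed_iInter fun i => isClosed_le (by fun_prop) continuous_const

lemma recentre_mem_closure_vertexClass [ProperSpace X]
    (hgeo : ∀ p q : X, ∃ c : ℝ → X, IsMinGeodesic p q c) (hN : 0 < N)
    (hr : ∀ p ∈ Metric.closedBall x L, ∀ q, dist p q < r → HasUniqueMinGeodesic p q)
    (hNr : 2 * L < r * N) {c : C(ℝ, X)} {q : ℕ → X}
    (hq : q ∈ closure (vertexClass x y L N c)) {i : ℕ} (hi : i + 2 ≤ N) :
    recentre i q ∈ closure (vertexClass x y L N c) := by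
  have hN' : (0 : ℝ) < N := by exact_mod_cast hN
  obtain ⟨-, -, hq1, hq2⟩ := closure_vertexClass_subset hN c hq
  have hu : HasUniqueMinGeodesic (q i) (q (i + 2)) := by
    refine hr _ (hq2 i) _ ?_
    have h1 := hq1 i
    have h2 := hq1 (i + 1)
    have h3 := dist_triangle (q i) (q (i + 1)) (q (i + 2))
    have : N * dist (q i) (q (i + 2)) < N * r := by
      have := mul_le_mul_of_nonneg_left h3 hN'.le
      linarith
    exact lt_of_mul_lt_mul_left this hN'.le
  have hcont : ContinuousAt (recentre i) q :=
    tendsto_id.update _ (hu.tendsto_geod hgeo ((continuous_apply i).tendsto q)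
      ((continuous_apply (i + 2)).tendsto q) tendsto_const_nhds
      (.of_forall fun _ => ⟨by norm_num, by norm_num⟩) ⟨by norm_num, by norm_num⟩)
  have := hcont.continuousWithinAt.mem_closure_image hq
  refine closure_mono ?_ this
  rintro _ ⟨_, ⟨c', hc', rfl⟩, rfl⟩
  obtain ⟨c'', h, hj⟩ := exists_joinedIn_recentre hgeo hN hr hNr hc'.mem_lipPaths hi
  exact ⟨c'', JoinedIn.trans hc' hj, h⟩

/-- The edges of an energy minimizing chain have equal length and are aligned. -/
lemma exists_edges_eq_of_isMinOn [ProperSpace X]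
    (hgeo : ∀ p q : X, ∃ c : ℝ → X, IsMinGeodesic p q c) (hN : 0 < N)
    (hr : ∀ p ∈ Metric.closedBall x L, ∀ q, dist p q < r → HasUniqueMinGeodesic p q)
    (hNr : 2 * L < r * N) {c : C(ℝ, X)} {q : ℕ → X}
    (hq : q ∈ closure (vertexClass x y L N c))
    (hmin : ∀ p ∈ closure (vertexClass x y L N c), vertexEnergy N q ≤ vertexEnergy N p) :
    ∃ v, 0 ≤ v ∧ v ≤ L ∧ (∀ i < N, N * dist (q i) (q (i + 1)) = v) ∧
      ∀ i, i + 2 ≤ N → N * dist (q i) (q (i + 2)) = 2 * v := by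
  obtain ⟨-, -, hq1, -⟩ := closure_vertexClass_subset hN c hq
  have key : ∀ i, i + 2 ≤ N → dist (q (i + 1)) (q (i + 2)) = dist (q i) (q (i + 1)) ∧
      dist (q i) (q (i + 2)) = 2 * dist (q i) (q (i + 1)) := by
    intro i hi
    have h1 := hmin _ (recentre_mem_closure_vertexClass hgeo hN hr hNr hq hi)
    rw [vertexEnergy_recentre hgeo hi] at h1
    have h2 := dist_triangle (q i) (q (i + 1)) (q (i + 2))
    have p0 : 0 ≤ dist (q i) (q (i + 2)) := dist_nonneg
    have p1 : 0 ≤ dist (q i) (q (i + 1)) := dist_nonneg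
    set d := dist (q i) (q (i + 2))
    set a := dist (q i) (q (i + 1))
    set b := dist (q (i + 1)) (q (i + 2))
    have h3 : d ^ 2 ≤ (a + b) ^ 2 := pow_le_pow_left₀ p0 h2 2
    have h4 : b - a = 0 := by
      apply pow_eq_zero_iff (two_ne_zero) |>.1
      nlinarith [sq_nonneg (b - a)]
    have h5 : b = a := by linarith
    refine ⟨h5, le_antisymm (by linarith) ?_⟩
    rw [h5] at h1
    exact le_of_sq_le_sq (by nlinarith) p0
  have hedge : ∀ i < N, dist (q i) (q (i + 1)) = dist (q 0) (q 1) := by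
    intro i
    induction i with
    | zero => intro _; rfl
    | succ i ih => intro hi; rw [(key i (by omega)).1, ih (by omega)]
  refine ⟨N * dist (q 0) (q 1), by positivity, hq1 0, fun i hi => by rw [hedge i hi],
    fun i hi => ?_⟩
  rw [(key i hi).2, hedge i (by omega)]
  ring

/-- If `τ` is the only local geodesic among the `L`-Lipschitz paths from `x` to `y`, then every
such path deforms to `τ` through such paths. -/
theorem joinedIn_lipPaths_of_unique [ProperSpace X]
    (hgeo : ∀ p q : X, ∃ c : ℝ → X, IsMinGeodesic p q c)
    (hloc : ∀ x : X, ∃ ρ > 0, ∀ p ∈ Metric.ball x ρ, ∀ q ∈ Metric.ball x ρ,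
      HasUniqueMinGeodesic p q)
    {τ : C(ℝ, X)} (hun : ∀ c ∈ lipPaths x y L, IsLocalGeodesic c → c = τ)
    {c : C(ℝ, X)} (hc : c ∈ lipPaths x y L) : JoinedIn (lipPaths x y L) c τ := by
  have hL := lipPaths_nonneg hc
  obtain ⟨r, hr0, hr⟩ := exists_forall_hasUniqueMinGeodesic hloc (isCompact_closedBall x L)
  obtain ⟨N, hN2, hNr⟩ : ∃ N : ℕ, 2 ≤ N ∧ 2 * L < r * N := by
    obtain ⟨n, hn⟩ := exists_nat_gt (2 * L / r)
    rw [div_lt_iff₀ hr0] at hn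
    refine ⟨n + 2, by omega, hn.trans ?_⟩
    push_cast
    nlinarith
  have hN : 0 < N := by omega
  have hN' : (0 : ℝ) < N := by exact_mod_cast hN
  have hcmem : vertices N c ∈ closure (vertexClass x y L N c) :=
    subset_closure ⟨c, JoinedIn.refl hc, rfl⟩
  have hcpt : IsCompact (closure (vertexClass x y L N c)) :=
    (isCompact_univ_pi fun _ : ℕ => isCompact_closedBall x L).of_isClosed_subset isClosed_closure
      fun p hp i _ => (closure_vertexClass_subset hN c hp).2.2.2 i
  obtain ⟨q, hq, hmin⟩ := hcpt.exists_isMinOn ⟨_, hcmem⟩ (continuous_vertexEnergy N).continuousOn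
  rw [isMinOn_iff] at hmin
  have hfin : ∀ p ∈ closure (vertexClass x y L N c),
      (∀ p' ∈ closure (vertexClass x y L N c), vertexEnergy N p ≤ vertexEnergy N p') →
      ⇑τ = brokenGeod N p := by
    intro p hp hpm
    obtain ⟨v, hv0, hvL, h1, h2⟩ := exists_edges_eq_of_isMinOn hgeo hN hr hNr hp hpm
    obtain ⟨d, hd, hde⟩ := exists_mem_lipPaths_brokenGeod hgeo hN hL
      (fun i hi => (h1 i hi).le.trans hvL)
    obtain ⟨hp0, hpN, -⟩ := closure_vertexClass_subset hN c hp
    rw [hp0, hpN] at hd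
    rw [← hun d hd (hde ▸ isLocalGeodesic_brokenGeod hgeo hN2 hv0 h1 h2), hde]
  obtain ⟨v, hv0, hvL, h1, h2⟩ := exists_edges_eq_of_isMinOn hgeo hN hr hNr hq hmin
  have hτ := hfin q hq hmin
  obtain ⟨hq0, hqN, hq1, hq2⟩ := closure_vertexClass_subset hN c hq
  rcases hvL.eq_or_lt with hvL | hvL
  · have hE : ∀ p ∈ closure (vertexClass x y L N c), vertexEnergy N p ≤ vertexEnergy N q := by
      intro p hp
      refine Finset.sum_le_sum fun i hi => pow_le_pow_left₀ dist_nonneg ?_ 2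
      have e1 := (closure_vertexClass_subset hN c hp).2.2.1 i
      rw [← hvL, ← h1 i (Finset.mem_range.1 hi)] at e1
      exact le_of_mul_le_mul_left e1 hN'
    have hτ' := hfin _ hcmem fun p hp => (hE _ hcmem).trans (hmin p hp)
    obtain ⟨c', hc', hj⟩ := exists_joinedIn_brokenGeod hgeo hN hr hNr hc
    rwa [DFunLike.coe_injective (hτ'.trans hc'.symm)]
  · set η := min ((L - v) / (2 * N)) r with hη
    have hη0 : 0 < η := lt_min (by have := sub_pos.2 hvL; positivity) hr0
    have hU : {p : ℕ → X | ∀ i ≤ N, dist (p i) (q i) < η} ∈ 𝓝 q := by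
      simp only [ofPred_forall]
      refine (biInter_mem (finite_Iic N)).2 fun i _ => ?_
      exact (isOpen_lt (by fun_prop) continuous_const).mem_nhds (by simpa using hη0)
    obtain ⟨_, hpU, ⟨c', hj, rfl⟩⟩ := mem_closure_iff_nhds.1 hq _ hU
    have hc' := hj.mem_lipPaths
    obtain ⟨c'', hc'', hj'⟩ := exists_joinedIn_brokenGeod hgeo hN hr hNr hc'
    refine (JoinedIn.trans hj hj').trans (joinedIn_brokenGeod_of_moved hgeo hN hL hr hNr
      (vertices_zero hc') (vertices_self hN hc') hq0 hqN (fun i hi => ?_) ?_ hc'' hτ)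
    · exact hr _ (dist_le_of_mem_lipPaths hc' _) _ ((hpU i hi).trans_le (min_le_right _ _))
    · intro s hs i hi
      have hg : ∀ i ≤ N, dist (geod (vertices N c' i) (q i) s) (q i) ≤ η := by
        intro i hi
        have hg := isMinGeodesic_geod hgeo (vertices N c' i) (q i)
        have := hg.dist_le s hs 1 ⟨zero_le_one, le_rfl⟩
        rw [hg.map_one] at this
        refine this.trans ?_
        have e1 : |s - 1| ≤ 1 := by rw [abs_le]; constructor <;> linarith [hs.1, hs.2]
        have := mul_le_mul_of_nonneg_left e1 (dist_nonneg (x := vertices N c' i) (y := q i))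
        linarith [hpU i hi]
      have e1 := hg i hi.le
      have e2 := hg (i + 1) hi
      rw [dist_comm] at e2
      have e3 := dist_triangle4 (geod (vertices N c' i) (q i) s) (q i) (q (i + 1))
        (geod (vertices N c' (i + 1)) (q (i + 1)) s)
      have e4 : η * (2 * N) ≤ L - v :=
        (le_div_iff₀ (by positivity)).1 (min_le_left ((L - v) / (2 * N)) r)
      have e5 := h1 i hi
      have e6 := mul_le_mul_of_nonneg_left (e3.trans (add_le_add_three e1 le_rfl e2)) hN'.le
      linarith

end EnergyMinimizer

section Length

variable {X : Type*} [MetricSpace X] {x y z : X} {L : ℝ}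

/-- The paths from `x` to `y` of length at most `L`, parametrized on `[0, 1]`. -/
def lenPaths (x y : X) (L : ℝ) : Set C(ℝ, X) :=
  {c | c 0 = x ∧ c 1 = y ∧ eVariationOn c (Icc 0 1) ≤ ENNReal.ofReal L}

lemma eVariationOn_le_of_dist_le {f : ℝ → X} (hL : 0 ≤ L)
    (h : ∀ s t, dist (f s) (f t) ≤ L * |s - t|) :
    eVariationOn f (Icc 0 1) ≤ ENNReal.ofReal L := by
  have hf : LipschitzOnWith L.toNNReal f univ :=
    (LipschitzWith.of_dist_le_mul fun s t => by
      rw [Real.dist_eq, Real.coe_toNNReal _ hL]; exact h s t).lipschitzOnWith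
  have := hf.comp_eVariationOn_le (g := (id : ℝ → ℝ)) (s := Icc 0 1) (mapsTo_univ _ _)
  rw [eVariationOn_id_Icc] at this
  simpa [ENNReal.ofReal] using this

lemma lipPaths_subset_lenPaths : lipPaths x y L ⊆ lenPaths x y L := fun _ hc =>
  ⟨hc.1 0 le_rfl, hc.2.1 1 le_rfl, eVariationOn_le_of_dist_le (lipPaths_nonneg hc) hc.2.2⟩

lemma joinedIn_lenPaths_of_eq {c c' : C(ℝ, X)} (H : unitInterval → ℝ → X)
    (hH : Continuous fun p : unitInterval × ℝ => H p.1 p.2) (h0 : ∀ t, H 0 t = c t)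
    (h1 : ∀ t, H 1 t = c' t) (hx : ∀ s, H s 0 = x) (hy : ∀ s, H s 1 = y)
    (hL : ∀ s, eVariationOn (H s) (Icc 0 1) ≤ ENNReal.ofReal L) :
    JoinedIn (lenPaths x y L) c c' := by
  let F : C(unitInterval, C(ℝ, X)) := ContinuousMap.curry ⟨_, hH⟩
  refine ⟨⟨F, ?_, ?_⟩, fun s => ⟨hx s, hy s, hL s⟩⟩
  · ext t; exact h0 t
  · ext t; exact h1 t

lemma joinedIn_lenPaths_comp {c : C(ℝ, X)} (hc : c ∈ lenPaths x y L) {σ σ' : ℝ → ℝ}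
    (hσ : Continuous σ) (hσ' : Continuous σ') (hm : MonotoneOn σ (Icc 0 1))
    (hm' : MonotoneOn σ' (Icc 0 1)) (h0 : σ 0 = 0) (h0' : σ' 0 = 0) (h1 : σ 1 = 1)
    (h1' : σ' 1 = 1) {d d' : C(ℝ, X)} (hd : ∀ t, d t = c (σ t)) (hd' : ∀ t, d' t = c (σ' t)) :
    JoinedIn (lenPaths x y L) d d' := by
  refine joinedIn_lenPaths_of_eq (fun s t => c ((1 - s) * σ t + s * σ' t)) (by fun_prop)
    (fun t => by simp [hd]) (fun t => by simp [hd']) (fun s => by simp [h0, h0', hc.1])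
    (fun s => by simp [h1, h1', hc.2.1]) fun s => ?_
  have hs0 : (0 : ℝ) ≤ s := s.2.1
  have hs1 : (0 : ℝ) ≤ 1 - s := sub_nonneg.2 s.2.2
  have hmono : MonotoneOn (fun t => (1 - (s : ℝ)) * σ t + s * σ' t) (Icc 0 1) := by
    intro a ha b hb hab
    exact add_le_add (mul_le_mul_of_nonneg_left (hm ha hb hab) hs1)
      (mul_le_mul_of_nonneg_left (hm' ha hb hab) hs0)
  refine (eVariationOn.comp_le_of_monotoneOn c _ hmono fun t ht => ?_).trans hc.2.2
  have a := hmono ⟨le_rfl, zero_le_one⟩ ht ht.1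
  have b := hmono ht ⟨zero_le_one, le_rfl⟩ ht.2
  simp only [h0, h0', h1, h1', mul_zero, mul_one, add_zero, sub_add_cancel] at a b
  exact ⟨a, b⟩

lemma lenPaths_congr {c c' : C(ℝ, X)} (hc : c ∈ lenPaths x y L) (h : EqOn c c' (Icc 0 1)) :
    c' ∈ lenPaths x y L :=
  ⟨by rw [← h ⟨le_rfl, zero_le_one⟩, hc.1], by rw [← h ⟨zero_le_one, le_rfl⟩, hc.2.1],
    by rw [← eVariationOn.congr h]; exact hc.2.2⟩

lemma joinedIn_lenPaths_of_eqOn {c c' : C(ℝ, X)} (hc : c ∈ lenPaths x y L)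
    (h : EqOn c c' (Icc 0 1)) : JoinedIn (lenPaths x y L) c c' := by
  have hκ : Continuous fun t : ℝ => max 0 (min 1 t) := by fun_prop
  have hκm : MonotoneOn (fun t : ℝ => max 0 (min 1 t)) (Icc 0 1) := fun a _ b _ hab =>
    max_le_max le_rfl (min_le_min le_rfl hab)
  have key : ∀ d : C(ℝ, X), d ∈ lenPaths x y L →
      JoinedIn (lenPaths x y L) d (d.comp ⟨_, hκ⟩) := fun d hd =>
    joinedIn_lenPaths_comp hd continuous_id hκ (monotone_id.monotoneOn _) hκm rfl (by simp) rfl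
      (by simp) (fun _ => rfl) (fun _ => rfl)
  have he : c.comp ⟨_, hκ⟩ = c'.comp ⟨_, hκ⟩ := by
    ext t
    exact h ⟨le_max_left _ _, max_le zero_le_one (min_le_left _ _)⟩
  exact (key c hc).trans (he ▸ (key c' (lenPaths_congr hc h)).symm)

/-- A path of length at most `L` is a reparametrization of an `L`-Lipschitz path. -/
lemma exists_monotoneOn_dist_le (hL : 0 < L) {c : C(ℝ, X)} (hc : c ∈ lenPaths x y L) :
    ∃ σ : ℝ → ℝ, ContinuousOn σ (Icc 0 1) ∧ MonotoneOn σ (Icc 0 1) ∧ σ 0 = 0 ∧ σ 1 = 1 ∧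
      ∀ s ∈ Icc (0 : ℝ) 1, ∀ t ∈ Icc (0 : ℝ) 1, dist (c s) (c t) ≤ L * |σ s - σ t| := by
  have hfin : ∀ a ∈ Icc (0 : ℝ) 1, ∀ b ∈ Icc (0 : ℝ) 1, eVariationOn c (Icc a b) ≠ ⊤ :=
    fun a ha b hb => ((eVariationOn.mono c (Icc_subset_Icc ha.1 hb.2)).trans
      hc.2.2).trans_lt ENNReal.ofReal_lt_top |>.ne
  have hbv : BoundedVariationOn c (Icc 0 1) :=
    hfin 0 ⟨le_rfl, zero_le_one⟩ 1 ⟨zero_le_one, le_rfl⟩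
  let v : ℝ → ℝ := fun t => (eVariationOn c (Icc 0 t)).toReal
  have hv : ∀ s ∈ Icc (0 : ℝ) 1, ∀ t ∈ Icc (0 : ℝ) 1, s ≤ t →
      v t - v s = (eVariationOn c (Icc s t)).toReal := by
    intro s hs t ht hst
    have := eVariationOn.Icc_add_Icc c (s := univ) hs.1 hst (mem_univ _)
    simp only [univ_inter] at this
    simp only [v]
    rw [← this, ENNReal.toReal_add (hfin _ ⟨le_rfl, zero_le_one⟩ _ hs) (hfin _ hs _ ht)]
    ring
  have hvm : MonotoneOn v (Icc 0 1) := fun s hs t ht hst => by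
    have := hv s hs t ht hst
    linarith [ENNReal.toReal_nonneg (a := eVariationOn c (Icc s t))]
  have hvd : ∀ s ∈ Icc (0 : ℝ) 1, ∀ t ∈ Icc (0 : ℝ) 1, s ≤ t → dist (c s) (c t) ≤ v t - v s := by
    intro s hs t ht hst
    rw [hv s hs t ht hst, dist_edist]
    exact ENNReal.toReal_mono (hfin _ hs _ ht)
      (eVariationOn.edist_le c (left_mem_Icc.2 hst) (right_mem_Icc.2 hst))
  have hv0 : v 0 = 0 := by simp [v]
  have hv1 : v 1 ≤ L := ENNReal.toReal_le_of_le_ofReal hL.le hc.2.2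
  have hvc : ContinuousOn v (Icc 0 1) := by
    intro a ha
    have h1 := hbv.tendsto_eVariationOn_Icc_zero_left (x := a) c.continuous.continuousWithinAt
    have h2 := hbv.tendsto_eVariationOn_Icc_zero_right a c.continuous.continuousWithinAt
    have h3 := (ENNReal.tendsto_toReal ENNReal.zero_ne_top).comp h1
    have h4 := (ENNReal.tendsto_toReal ENNReal.zero_ne_top).comp h2
    rw [ContinuousWithinAt, tendsto_iff_dist_tendsto_zero]
    have h5 := h3.add h4
    rw [ENNReal.toReal_zero, add_zero] at h5
    refine squeeze_zero' (.of_forall fun _ => dist_nonneg) ?_ h5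
    filter_upwards [self_mem_nhdsWithin] with t ht
    have hI : ∀ a ∈ Icc (0 : ℝ) 1, ∀ b ∈ Icc (0 : ℝ) 1, Icc 0 1 ∩ Icc a b = Icc a b :=
      fun a ha b hb => inter_eq_right.2 (Icc_subset_Icc ha.1 hb.2)
    simp only [Function.comp_apply, hI a ha t ht, hI t ht a ha]
    rw [Real.dist_eq]
    rcases le_total t a with h | h
    · have := hvm ht ha h
      rw [abs_sub_comm, abs_of_nonneg (by linarith), hv t ht a ha h]
      linarith [ENNReal.toReal_nonneg (a := eVariationOn c (Icc a t))]
    · have := hvm ha ht h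
      rw [abs_of_nonneg (by linarith), hv a ha t ht h]
      linarith [ENNReal.toReal_nonneg (a := eVariationOn c (Icc t a))]
  refine ⟨fun t => (v t + (L - v 1) * t) / L, by fun_prop, fun s hs t ht hst => ?_, by simp [hv0],
    by field_simp; ring, ?_⟩
  · have := hvm hs ht hst
    have := mul_le_mul_of_nonneg_left hst (sub_nonneg.2 hv1)
    exact div_le_div_of_nonneg_right (by linarith) hL.le
  · have key : ∀ s ∈ Icc (0 : ℝ) 1, ∀ t ∈ Icc (0 : ℝ) 1, s ≤ t → dist (c s) (c t) ≤
        L * |(v s + (L - v 1) * s) / L - (v t + (L - v 1) * t) / L| := by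
      intro s hs t ht hst
      rw [← sub_div, abs_div, abs_of_pos hL, mul_div_cancel₀ _ hL.ne', abs_sub_comm]
      have := mul_le_mul_of_nonneg_left hst (sub_nonneg.2 hv1)
      have := hvd s hs t ht hst
      exact le_trans (by linarith) (le_abs_self _)
    intro s hs t ht
    rcases le_total s t with h | h
    · exact key s hs t ht h
    · rw [dist_comm, abs_sub_comm]; exact key t ht s hs h

/-- Every path of length at most `L` deforms to an `L`-Lipschitz path. -/
lemma exists_joinedIn_lipPaths (hL : 0 < L) {c : C(ℝ, X)} (hc : c ∈ lenPaths x y L) :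
    ∃ c' ∈ lipPaths x y L, JoinedIn (lenPaths x y L) c c' := by
  obtain ⟨σ, hσ, hm, h0, h1, hd⟩ := exists_monotoneOn_dist_le hL hc
  have hsurj : ∀ u ∈ Icc (0 : ℝ) 1, ∃ t ∈ Icc (0 : ℝ) 1, σ t = u := by
    have := intermediate_value_Icc zero_le_one hσ
    rwa [h0, h1] at this
  choose! g hg hσg using hsurj
  let κ : ℝ → ℝ := fun t => max 0 (min 1 t)
  have hκ : ∀ t, κ t ∈ Icc (0 : ℝ) 1 := fun t =>
    ⟨le_max_left _ _, max_le zero_le_one (min_le_left _ _)⟩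
  have hκc : Continuous κ := by fun_prop
  have hκI : ∀ t ∈ Icc (0 : ℝ) 1, κ t = t := fun t ht => by
    simp only [κ]; rw [min_eq_right ht.2, max_eq_right ht.1]
  have hκL : ∀ s t, |κ s - κ t| ≤ |s - t| := fun s t => by
    refine (abs_max_sub_max_le_max _ _ _ _).trans (max_le (by simp) ?_)
    exact (abs_min_sub_min_le_max _ _ _ _).trans (max_le (by simp) le_rfl)
  have hκ0 : ∀ t ≤ 0, κ t = 0 := fun t ht => max_eq_left ((min_le_right _ _).trans ht)
  have hκ1 : ∀ t, 1 ≤ t → κ t = 1 := fun t ht => by simp only [κ]; rw [min_eq_left ht]; simp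
  have hσc : Continuous fun t => σ (κ t) :=
    hσ.comp_continuous hκc hκ
  have heq : ∀ a ∈ Icc (0 : ℝ) 1, ∀ b ∈ Icc (0 : ℝ) 1, σ a = σ b → c a = c b := fun a ha b hb h => by
    have := hd a ha b hb
    rw [h, sub_self, abs_zero, mul_zero] at this
    exact dist_le_zero.1 this
  have h0m : (0 : ℝ) ∈ Icc (0 : ℝ) 1 := ⟨le_rfl, zero_le_one⟩
  have h1m : (1 : ℝ) ∈ Icc (0 : ℝ) 1 := ⟨zero_le_one, le_rfl⟩
  have hLip : ∀ s t, dist (c (g (κ s))) (c (g (κ t))) ≤ L * |s - t| := fun s t => by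
    have := hd _ (hg _ (hκ s)) _ (hg _ (hκ t))
    rw [hσg _ (hκ s), hσg _ (hκ t)] at this
    exact this.trans (mul_le_mul_of_nonneg_left (hκL s t) hL.le)
  let c' : C(ℝ, X) := ⟨fun t => c (g (κ t)), continuous_of_dist_le hLip⟩
  have hc' : c' ∈ lipPaths x y L := by
    refine ⟨fun t ht => ?_, fun t ht => ?_, hLip⟩
    · change c (g (κ t)) = x
      rw [hκ0 t ht, ← hc.1]
      exact heq _ (hg _ h0m) _ h0m (by rw [hσg _ h0m, h0])
    · change c (g (κ t)) = y
      rw [hκ1 t ht, ← hc.2.1]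
      exact heq _ (hg _ h1m) _ h1m (by rw [hσg _ h1m, h1])
  have hσI : ∀ t ∈ Icc (0 : ℝ) 1, σ t ∈ Icc (0 : ℝ) 1 := fun t ht =>
    ⟨h0 ▸ hm h0m ht ht.1, h1 ▸ hm ht h1m ht.2⟩
  refine ⟨c', hc', (joinedIn_lenPaths_of_eqOn (c' := c'.comp ⟨_, hσc⟩) hc fun t ht => ?_).trans
    (joinedIn_lenPaths_comp (lipPaths_subset_lenPaths hc') hσc continuous_id (fun a ha b hb hab => ?_)
      (monotone_id.monotoneOn _) ?_ rfl ?_ rfl (fun _ => rfl) fun _ => rfl)⟩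
  · change c t = c (g (κ (σ (κ t))))
    rw [hκI t ht, hκI _ (hσI t ht)]
    exact heq _ ht _ (hg _ (hσI t ht)) (hσg _ (hσI t ht)).symm
  · change σ (κ a) ≤ σ (κ b)
    rw [hκI a ha, hκI b hb]
    exact hm ha hb hab
  · rw [hκI 0 h0m, h0]
  · rw [hκI 1 h1m, h1]

end Length

section Concatenation

variable {X : Type*}

/-- The concatenation of two paths parametrized on `[0, 1]`. -/
noncomputable def cat (c d : ℝ → X) : ℝ → X := fun t => if t ≤ 1 / 2 then c (2 * t) else d (2 * t - 1)

lemma cat_zero (c d : ℝ → X) : cat c d 0 = c 0 := by simp [cat]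

lemma cat_one (c d : ℝ → X) : cat c d 1 = d 1 := by norm_num [cat]

lemma cat_of_le {c d : ℝ → X} {t : ℝ} (ht : t ≤ 1 / 2) : cat c d t = c (2 * t) := if_pos ht

lemma cat_of_ge {c d : ℝ → X} (h : c 1 = d 0) {t : ℝ} (ht : 1 / 2 ≤ t) :
    cat c d t = d (2 * t - 1) := by
  rcases ht.eq_or_lt with rfl | ht
  · rw [cat_of_le le_rfl]; norm_num [h]
  · exact if_neg ht.not_ge

variable [MetricSpace X]

lemma continuous_cat {Y : Type*} [TopologicalSpace Y] {f g : Y → ℝ → X}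
    (hf : Continuous fun p : Y × ℝ => f p.1 p.2) (hg : Continuous fun p : Y × ℝ => g p.1 p.2)
    (h : ∀ y, f y 1 = g y 0) : Continuous fun p : Y × ℝ => cat (f p.1) (g p.1) p.2 := by
  refine Continuous.if_le (hf.comp (by fun_prop : Continuous fun p : Y × ℝ => (p.1, 2 * p.2)))
    (hg.comp (by fun_prop : Continuous fun p : Y × ℝ => (p.1, 2 * p.2 - 1))) (by fun_prop)
    (by fun_prop) fun p hp => ?_
  norm_num [hp, h]

lemma eVariationOn_cat_le {c d : ℝ → X} (h : c 1 = d 0) :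
    eVariationOn (cat c d) (Icc 0 1) ≤ eVariationOn c (Icc 0 1) + eVariationOn d (Icc 0 1) := by
  have := eVariationOn.Icc_add_Icc (cat c d) (s := univ) (a := 0) (b := 1 / 2) (c := 1)
    (by norm_num) (by norm_num) (mem_univ _)
  simp only [univ_inter] at this
  rw [← this]
  refine add_le_add ?_ ?_
  · rw [eVariationOn.congr (g := c ∘ fun t => 2 * t) fun t ht => cat_of_le ht.2]
    refine eVariationOn.comp_le_of_monotoneOn c _ (fun a _ b _ hab => ?_) fun t ht => ?_
    · change 2 * a ≤ 2 * b; linarith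
    · constructor <;> linarith [ht.1, ht.2]
  · rw [eVariationOn.congr (g := d ∘ fun t => 2 * t - 1) fun t ht => cat_of_ge h ht.1]
    refine eVariationOn.comp_le_of_monotoneOn d _ (fun a _ b _ hab => ?_) fun t ht => ?_
    · change 2 * a - 1 ≤ 2 * b - 1; linarith
    · constructor <;> linarith [ht.1, ht.2]

variable {x y z : X}

/-- Concatenate a path with a fixed one. -/
noncomputable def catPath (c d : C(ℝ, X)) (h : c 1 = d 0) : C(ℝ, X) :=
  ⟨cat c d, (continuous_cat (Y := Unit) (f := fun _ => c) (g := fun _ => d) (by fun_prop)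
    (by fun_prop) fun _ => h).comp (Continuous.prodMk_right ())⟩

lemma catPath_mem_lenPaths {L₁ L₂ : ℝ} (h₁ : 0 ≤ L₁) (h₂ : 0 ≤ L₂) {c d : C(ℝ, X)}
    (hc : c ∈ lenPaths x y L₁) (hd : d ∈ lenPaths y z L₂) :
    catPath c d (hc.2.1.trans hd.1.symm) ∈ lenPaths x z (L₁ + L₂) := by
  refine ⟨(cat_zero _ _).trans hc.1, (cat_one _ _).trans hd.2.1, ?_⟩
  rw [ENNReal.ofReal_add h₁ h₂]
  exact (eVariationOn_cat_le (hc.2.1.trans hd.1.symm)).trans (add_le_add hc.2.2 hd.2.2)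

lemma joinedIn_catPath {L₁ L₂ : ℝ} (h₁ : 0 ≤ L₁) (h₂ : 0 ≤ L₂) {c c' d : C(ℝ, X)}
    (h : JoinedIn (lenPaths x y L₁) c c') (hd : d ∈ lenPaths y z L₂) :
    JoinedIn (lenPaths x z (L₁ + L₂)) (catPath c d (h.source_mem.2.1.trans hd.1.symm))
      (catPath c' d (h.target_mem.2.1.trans hd.1.symm)) := by
  obtain ⟨F, hF⟩ := h
  have hFd : ∀ s, F s 1 = d 0 := fun s => (hF s).2.1.trans hd.1.symm
  refine joinedIn_lenPaths_of_eq (fun s => cat (F s) d)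
    (continuous_cat (f := fun s t => F s t) (g := fun _ t => d t)
      (ContinuousMap.continuous_uncurry_of_continuous F.toContinuousMap) (by fun_prop) hFd)
    (fun t => ?_) (fun t => ?_) (fun s => (cat_zero _ _).trans (hF s).1)
    (fun s => (cat_one _ _).trans hd.2.1) fun s => ?_
  · rw [F.source]; rfl
  · rw [F.target]; rfl
  · exact (catPath_mem_lenPaths h₁ h₂ (hF s) hd).2.2

/-- A path deforms to its concatenation with a Lipschitz path and the inverse of that path. -/
lemma joinedIn_catPath_rev {l : ℝ} (hl : 0 ≤ l) {c β β' : C(ℝ, X)} (hc : c ∈ lenPaths x z l)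
    (hβ : β ∈ lipPaths z y l) (hβ' : ∀ t, β' t = β (1 - t)) (h : c 1 = β 0)
    (h' : (catPath c β h) 1 = β' 0) :
    JoinedIn (lenPaths x z (3 * l)) c (catPath (catPath c β h) β' h') := by
  have hm : ∀ s : unitInterval, c 1 = β (s * 0) := fun s => by rw [mul_zero, h]
  have hm' : ∀ s : unitInterval, cat c (fun t => β (s * t)) 1 = β (s * (1 - 0)) := fun s => by
    rw [cat_one, sub_zero]
  have hs : ∀ s : unitInterval, |(s : ℝ)| ≤ 1 := fun s => by rw [abs_of_nonneg s.2.1]; exact s.2.2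
  have hvar : ∀ (s : unitInterval) (f : ℝ → ℝ), (∀ a b, |f a - f b| = |a - b|) →
      eVariationOn (fun t => β (s * f t)) (Icc 0 1) ≤ ENNReal.ofReal l := by
    intro s f hf
    refine eVariationOn_le_of_dist_le hl fun a b => (hβ.2.2 _ _).trans ?_
    rw [← mul_sub, abs_mul, hf]
    exact mul_le_mul_of_nonneg_left (mul_le_of_le_one_left (abs_nonneg _) (hs s)) hl
  have hcont : Continuous fun p : unitInterval × ℝ =>
      cat (cat c fun t => β (p.1 * t)) (fun t => β (p.1 * (1 - t))) p.2 :=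
    continuous_cat (f := fun s : unitInterval => cat c fun t => β (s * t))
      (g := fun s t => β (s * (1 - t)))
      (continuous_cat (f := fun (_ : unitInterval) t => c t) (g := fun s t => β (s * t))
        (by fun_prop) (by fun_prop) hm) (by fun_prop) hm'
  have hσ : Continuous fun t : ℝ => min (4 * t) 1 := by fun_prop
  have h0 : β 0 = z := hβ.1 0 le_rfl
  have hreparam : JoinedIn (lenPaths x z (3 * l)) c (c.comp ⟨_, hσ⟩) :=
    joinedIn_lenPaths_comp (L := 3 * l)
      ⟨hc.1, hc.2.1, hc.2.2.trans (ENNReal.ofReal_le_ofReal (by linarith))⟩ continuous_id hσ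
      (monotone_id.monotoneOn _) (fun a _ b _ hab => min_le_min (by linarith) le_rfl) rfl (by simp)
      rfl (by norm_num) (fun _ => rfl) fun _ => rfl
  refine hreparam.trans (joinedIn_lenPaths_of_eq
    (fun s => cat (cat c fun t => β (s * t)) (fun t => β (s * (1 - t)))) hcont (fun t => ?_)
    (fun t => ?_) (fun s => by rw [cat_zero, cat_zero, hc.1]) (fun s => ?_) fun s => ?_)
  · have hz : ∀ t, 1 / 4 ≤ t → z = c (min (4 * t) 1) := fun t ht => by
      rw [min_eq_right (by linarith), hc.2.1]
    simp only [Set.Icc.coe_zero, zero_mul, h0, ContinuousMap.comp_apply, ContinuousMap.coe_mk]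
    simp only [cat]
    split_ifs with h1 h2
    · rw [min_eq_left (by linarith)]
      congr 1; ring
    · exact hz t (by linarith)
    · exact hz t (by linarith)
  · have e1 : (fun t => β (1 - t)) = β' := funext fun t => (hβ' t).symm
    simp only [Set.Icc.coe_one, one_mul, e1]
    rfl
  · rw [cat_one, sub_self, mul_zero, h0]
  · refine (eVariationOn_cat_le (hm' s)).trans ?_
    have e : (3 : ℝ) * l = l + l + l := by ring
    rw [e, ENNReal.ofReal_add (by linarith) hl, ENNReal.ofReal_add hl hl]
    refine add_le_add ((eVariationOn_cat_le (hm s)).trans (add_le_add hc.2.2 ?_)) ?_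
    · exact hvar s id fun _ _ => rfl
    · exact hvar s (fun t => 1 - t) fun a b => by rw [sub_sub_sub_cancel_left, abs_sub_comm]

end Concatenation

section Homotopy

variable {X : Type*} [MetricSpace X] {x y z : X}

lemma exists_mem_lipPaths (hgeo : ∀ p q : X, ∃ c : ℝ → X, IsMinGeodesic p q c) {l : ℝ}
    (h : dist x y ≤ l) : ∃ c, c ∈ lipPaths x y l := by
  obtain ⟨c, hc, -⟩ := exists_mem_lipPaths_brokenGeod hgeo one_pos (dist_nonneg.trans h)
    (p := fun i => if i = 0 then x else y) (L := l) fun i hi => by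
      obtain rfl : i = 0 := by omega
      simpa using h
  exact ⟨c, by simpa using hc⟩

lemma comp_one_sub_mem_lipPaths {l : ℝ} {c c' : C(ℝ, X)} (hc : c ∈ lipPaths x y l)
    (h : ∀ t, c' t = c (1 - t)) : c' ∈ lipPaths y x l := by
  refine ⟨fun t ht => ?_, fun t ht => ?_, fun s t => ?_⟩
  · rw [h, hc.2.1 _ (by linarith)]
  · rw [h, hc.1 _ (by linarith)]
  · rw [h, h, abs_sub_comm]
    simpa using hc.2.2 (1 - s) (1 - t)

/-- If there is at most one local geodesic of length at most `2 * l` from `x` to `y` and `z` is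
within distance `l` of `y`, then any two paths of length at most `l` from `x` to `z` are homotopic
through paths of length at most `3 * l`. -/
theorem joinedIn_lenPaths_of_unique [ProperSpace X]
    (hgeo : ∀ p q : X, ∃ c : ℝ → X, IsMinGeodesic p q c)
    (hloc : ∀ x : X, ∃ ρ > 0, ∀ p ∈ Metric.ball x ρ, ∀ q ∈ Metric.ball x ρ,
      HasUniqueMinGeodesic p q)
    {l : ℝ} (hl : 0 < l) (hyz : dist y z ≤ l) {τ : C(ℝ, X)}
    (hun : ∀ c ∈ lipPaths x y (2 * l), IsLocalGeodesic c → c = τ)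
    {c c' : C(ℝ, X)} (hc : c ∈ lenPaths x z l) (hc' : c' ∈ lenPaths x z l) :
    JoinedIn (lenPaths x z (3 * l)) c c' := by
  obtain ⟨β, hβ⟩ := exists_mem_lipPaths hgeo ((dist_comm z y).trans_le hyz)
  let β' : C(ℝ, X) := β.comp ⟨fun t => 1 - t, by fun_prop⟩
  have hβ' : ∀ t, β' t = β (1 - t) := fun _ => rfl
  have hβm := lipPaths_subset_lenPaths hβ
  have hβm' := lipPaths_subset_lenPaths (comp_one_sub_mem_lipPaths hβ hβ')
  have e2 : 2 * l = l + l := by ring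
  have e3 : 3 * l = 2 * l + l := by ring
  have key : ∀ c ∈ lenPaths x z l, ∃ h : τ 1 = β' 0,
      JoinedIn (lenPaths x z (3 * l)) c (catPath τ β' h) := by
    intro c hc
    have hm := catPath_mem_lenPaths hl.le hl.le hc hβm
    rw [← e2] at hm
    obtain ⟨d, hd, hj⟩ := exists_joinedIn_lipPaths (by linarith) hm
    have hj' := hj.trans ((joinedIn_lipPaths_of_unique hgeo hloc hun hd).mono
      lipPaths_subset_lenPaths)
    have h1 := joinedIn_catPath (by linarith) hl.le hj' hβm'
    rw [← e3] at h1
    exact ⟨_, (joinedIn_catPath_rev hl.le hc hβ hβ' (hc.2.1.trans hβm.1.symm)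
      (hm.2.1.trans hβm'.1.symm)).trans h1⟩
  obtain ⟨_, h⟩ := key c hc
  obtain ⟨_, h'⟩ := key c' hc'
  exact h.trans h'.symm

lemma pathLength_eq_eVariationOn {γ : Path x y} {c : ℝ → X} (h : ∀ t : unitInterval, c t = γ t) :
    pathLength γ = eVariationOn c (Icc 0 1) := by
  have := eVariationOn.comp_eq_of_monotoneOn c (t := univ) ((↑) : unitInterval → ℝ)
    (fun _ _ _ _ h => h)
  rw [image_univ, Subtype.range_coe] at this
  rw [← this, pathLength]
  exact eVariationOn.congr fun t _ => (h t).symm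

lemma extend_mem_lenPaths {γ : Path x y} {l : ℝ} (h : pathLength γ ≤ ENNReal.ofReal l) :
    (⟨γ.extend, γ.continuous_extend⟩ : C(ℝ, X)) ∈ lenPaths x y l :=
  ⟨γ.extend_zero, γ.extend_one,
    (pathLength_eq_eVariationOn fun t => γ.extend_apply t.2).symm.trans_le h⟩

lemma IsLocalGeodesic.isGeodesicPath {c : ℝ → X} (hc : IsLocalGeodesic c) {γ : Path x y}
    (h : ∀ t : unitInterval, c t = γ t) : IsGeodesicPath γ := by
  obtain ⟨v, hv, H⟩ := hc
  refine ⟨v, hv, fun t => ?_⟩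
  obtain ⟨δ, hδ, H⟩ := H t t.2
  refine ⟨Metric.ball t δ, Metric.ball_mem_nhds t hδ, fun s hs s' hs' => ?_⟩
  rw [← h, ← h]
  exact H s s.2 s' s'.2 hs hs'

lemma eq_extend_of_existsUnique {L : ℝ} {τ : Path x y}
    (hun : ∀ γ : Path x y, IsGeodesicPath γ ∧ pathLength γ ≤ ENNReal.ofReal L → γ = τ)
    {c : C(ℝ, X)} (hc : c ∈ lipPaths x y L) (hcl : IsLocalGeodesic c) :
    c = ⟨τ.extend, τ.continuous_extend⟩ := by
  let γ : Path x y := ⟨⟨fun t => c t, by fun_prop⟩, hc.1 0 le_rfl, hc.2.1 1 le_rfl⟩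
  have hγ : ∀ t : unitInterval, c t = γ t := fun _ => rfl
  have e := hun γ ⟨hcl.isGeodesicPath hγ,
    (pathLength_eq_eVariationOn hγ).trans_le (lipPaths_subset_lenPaths hc).2.2⟩
  ext t
  change c t = τ.extend t
  rcases le_or_gt t 0 with h | h
  · rw [τ.extend_of_le_zero h, hc.1 t h]
  rcases le_or_gt 1 t with h1 | h1
  · rw [τ.extend_of_one_le h1, hc.2.1 t h1]
  · rw [τ.extend_apply ⟨h.le, h1.le⟩, ← e]
    rfl

/-- A deformation through paths of bounded length yields a homotopy of paths. -/
lemma exists_homotopy_of_joinedIn {L : ℝ} {γ γ' : Path x y}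
    (h : JoinedIn (lenPaths x y L) ⟨γ.extend, γ.continuous_extend⟩
      ⟨γ'.extend, γ'.continuous_extend⟩) :
    ∃ F : Path.Homotopy γ γ', ∀ s : unitInterval, pathLength (F.eval s) ≤ ENNReal.ofReal L := by
  obtain ⟨G, hG⟩ := h
  have hcont : Continuous fun p : unitInterval × unitInterval => G p.1 (p.2 : ℝ) :=
    (ContinuousMap.continuous_uncurry_of_continuous G.toContinuousMap).comp
      (by fun_prop : Continuous fun p : unitInterval × unitInterval => (p.1, (p.2 : ℝ)))
  have h0 : ∀ t : unitInterval, G 0 t = γ t := fun t => by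
    rw [G.source]; exact γ.extend_apply t.2
  have h1 : ∀ t : unitInterval, G 1 t = γ' t := fun t => by
    rw [G.target]; exact γ'.extend_apply t.2
  refine ⟨⟨⟨⟨_, hcont⟩, h0, h1⟩, fun s t ht => ?_⟩, fun s => ?_⟩
  · rcases ht with rfl | rfl
    · exact (hG s).1.trans γ.source.symm
    · exact (hG s).2.1.trans γ.target.symm
  · exact (pathLength_eq_eVariationOn (c := G s) fun _ => rfl).trans_le (hG s).2.2

end Homotopy

theorem lemma5 {n : ℕ} {M : Type*} [MetricSpace M] [ChartedSpace (EuclideanSpace ℝ (Fin n)) M]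
    [IsManifold (𝓡 n) ∞ M]
    [Bundle.RiemannianBundle (fun p : M => TangentSpace (𝓡 n) p)]
    [IsContMDiffRiemannianBundle (𝓡 n) ∞ (EuclideanSpace ℝ (Fin n))
      (fun p : M => TangentSpace (𝓡 n) p)]
    [IsRiemannianManifold (𝓡 n) M] [CompleteSpace M]
    (l : ℝ) (hl : 0 < l) (x y z : M) (γ₁ γ₂ : Path x z)
    (hγ₁ : pathLength γ₁ ≤ ENNReal.ofReal l) (hγ₂ : pathLength γ₂ ≤ ENNReal.ofReal l)
    (hyz : dist y z ≤ l)
    (hgeod : ∃! τ : Path x y, IsGeodesicPath τ ∧ pathLength τ ≤ ENNReal.ofReal (2 * l)) :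
    ∃ F : Path.Homotopy γ₁ γ₂, ∀ s : unitInterval, pathLength (F.eval s) ≤ ENNReal.ofReal (3 * l) :=
  by
  have hlen : ∀ (p q : M) (a b : ℝ), 0 < a → 0 < b → dist p q < a + b →
      ∃ m, dist p m < a ∧ dist m q < b := fun p q a b ha hb h =>
    exists_dist_lt_and_dist_lt (EuclideanSpace ℝ (Fin n)) p q ha hb h
  have : LocallyCompactSpace M := ChartedSpace.locallyCompactSpace (EuclideanSpace ℝ (Fin n)) M
  have : ProperSpace M := properSpace_of_exists_dist_lt hlen
  have hgeo : ∀ p q : M, ∃ c : ℝ → M, IsMinGeodesic p q c := exists_isMinGeodesic hlen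
  have hloc : ∀ x : M, ∃ ρ > 0, ∀ p ∈ Metric.ball x ρ, ∀ q ∈ Metric.ball x ρ,
      HasUniqueMinGeodesic p q := fun x => by
    obtain ⟨φ, ψ, Q, r, C, lam, h⟩ := exists_isLocalMetricModel (E := EuclideanSpace ℝ (Fin n)) x
    exact h.exists_eqOn_of_isMinGeodesic
  obtain ⟨τ, -, hun⟩ := hgeod
  exact exists_homotopy_of_joinedIn (joinedIn_lenPaths_of_unique hgeo hloc hl hyz
    (fun c hc hcl => eq_extend_of_existsUnique hun hc hcl) (extend_mem_lenPaths hγ₁)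
    (extend_mem_lenPaths hγ₂))
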